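/- Let $T=\{[z_0,z_1,z_2,z_3]\in\mathbf P^3 : (z_0,z_1)\neq(0,0)\}$ be the complement of a line in $\mathbf P^3$, on which the additive group $\mathbf C$ acts by $t\cdot[z_0,z_1,z_2,z_3]=[z_0,z_1,z_2+tz_0,z_3-tz_1]$. Let $\mathcal O(2)$ also denote the total space of the line bundle $\pi:\mathcal O(2)\to\mathbf P^1$, with points $[z_0,z_1;w]=[cz_0,cz_1;c^2w]$ ($c\in\mathbf C^*$), and let $w$ be the tautological section of $\pi^*\mathcal O(2)$. Let $U_0=\{z_0\ne0\}$ and $U_1=\{z_1\ne0\}$. Let $[\omega]\in H^1(\mathbf P^1,K)\cong H^1(\mathbf P^1,\mathcal O(-2))$ be the Dolbeault class of the standard $(1,1)$-form $\omega=dz\wedge d\bar z/(1+z\bar z)^2$, $z=z_1/z_0$, where $K\cong\mathcal O(-2)$ is given by $f\,(z_0dz_1-z_1dz_0)\leftrightarrow f$, and let $w[\omega]\in H^1(\mathcal O(2),\mathcal O)$ be the product of (the pull-back of) $[\omega]$ with $w$. (This is the class whose exponentials $\exp(t\,w[\omega])\in H^1(\mathcal O(2),\mathcal O^*)$ give the Nahm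 flow.) Then: (1) The map $T\to\mathcal O(2)$, $[z_0,z_1,z_2,z_3]\mapsto[z_0,z_1;z_1z_2+z_3z_0]$, together with the above action, is a holomorphic principal $\mathbf C$-bundle. It therefore has a well-defined class $\alpha\in H^1(\mathcal O(2),\mathcal O)$, namely the Čech class of the functions $g_{ij}$ with $g_{ij}\cdot s_i=s_j$ for local holomorphic sections $s_i$. (2) There is a non-zero constant $c$ with $\alpha=c\,w[\omega]$. (3) Both $\alpha$ and $w[\omega]$ are represented by the Čech cocycle on the cover $\{\pi^{-1}U_0,\pi^{-1}U_1\}$ of $\mathcal O(2)$ whose value on $\pi^{-1}(U_0\cap U_1)$ is $w/(z_0z_1)$. Here a Čech class is attached to $\omega$ through local smooth $(1,0)$-forms $\eta_i$ with $\bar\partial\eta_i=\omega$ and the cocycle $\eta_j-\eta_i$. -/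

import Mathlib

open scoped LinearAlgebra.Projectivization Manifold ContDiff
open TopologicalSpace CategoryTheory Opposite

noncomputable section

namespace Twistor

/-! ## Čech cohomology in degree one -/

section Cech

variable {X : Type} [TopologicalSpace X] (F : TopCat.Presheaf (ModuleCat.{0} ℂ) (TopCat.of X))

/-- Sections over an open set. -/
abbrev Sec (U : Opens X) : Type := F.obj (op (U : Opens (TopCat.of X)))

/-- Restriction of sections to a smaller open set. -/
def res {U V : Opens X} (h : V ≤ U) : Sec F U →ₗ[ℂ] Sec F V :=
  (F.map (homOfLE (X := Opens (TopCat.of X)) h).op).hom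

lemma res_res {U V W : Opens X} (h : V ≤ U) (h' : W ≤ V) (s : Sec F U) :
    res F h' (res F h s) = res F (h'.trans h) s := by
  have := F.map_comp (homOfLE (X := Opens (TopCat.of X)) h).op
    (homOfLE (X := Opens (TopCat.of X)) h').op
  exact (congrArg (fun f => f.hom s) this).symm

/-- Čech 1-cocycles of a family of open sets: `g i j ∈ F (V i ∩ V j)` with
`g i j + g j k = g i k` on `V i ∩ V j ∩ V k`. -/
def cocycles {ι : Type} (V : ι → Opens X) : Submodule ℂ (∀ i j, Sec F (V i ⊓ V j)) where
  carrier := {g | ∀ i j k,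
    res F (inf_le_left : V i ⊓ V j ⊓ V k ≤ V i ⊓ V j) (g i j)
      + res F (inf_le_inf_right (V k) inf_le_right : V i ⊓ V j ⊓ V k ≤ V j ⊓ V k) (g j k)
      = res F (inf_le_inf_right (V k) inf_le_left : V i ⊓ V j ⊓ V k ≤ V i ⊓ V k) (g i k)}
  zero_mem' := by intro i j k; simp
  add_mem' := by
    intro a b ha hb i j k
    have h1 := ha i j k
    have h2 := hb i j k
    simp only [Pi.add_apply, map_add, ← h1, ← h2]
    abel
  smul_mem' := by
    intro c a ha i j k
    have h1 := ha i j k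
    simp only [Pi.smul_apply, map_smul, ← h1, smul_add]

/-- The Čech differential `(δ f) i j = f j - f i`. -/
def coboundary {ι : Type} (V : ι → Opens X) : (∀ i, Sec F (V i)) →ₗ[ℂ] cocycles F V where
  toFun f := ⟨fun i j => res F inf_le_right (f j) - res F inf_le_left (f i), by
    intro i j k
    simp only [map_sub, res_res]
    abel⟩
  map_add' a b := by
    ext i j
    simp only [Pi.add_apply, map_add, Submodule.coe_add]
    abel
  map_smul' c a := by
    ext i j
    simp only [Pi.smul_apply, map_smul, SetLike.val_smul, RingHom.id_apply, smul_sub]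

/-- The first Čech cohomology of a family of open sets. -/
def CoverH1 {ι : Type} (V : ι → Opens X) : Type :=
  cocycles F V ⧸ LinearMap.range (coboundary F V)

instance {ι : Type} (V : ι → Opens X) : AddCommGroup (CoverH1 F V) :=
  inferInstanceAs (AddCommGroup (cocycles F V ⧸ LinearMap.range (coboundary F V)))

instance {ι : Type} (V : ι → Opens X) : Module ℂ (CoverH1 F V) :=
  inferInstanceAs (Module ℂ (cocycles F V ⧸ LinearMap.range (coboundary F V)))

/-- The class of a cocycle in the cohomology of the family. -/
def coverClass {ι : Type} (V : ι → Opens X) : cocycles F V →ₗ[ℂ] CoverH1 F V :=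
  Submodule.mkQ (LinearMap.range (coboundary F V))

lemma coverClass_coboundary {ι : Type} (V : ι → Opens X) (f : ∀ i, Sec F (V i)) :
    coverClass F V (coboundary F V f) = 0 :=
  (Submodule.Quotient.mk_eq_zero (LinearMap.range (coboundary F V))).2
    (LinearMap.mem_range_self _ f)

lemma coverClass_surjective {ι : Type} (V : ι → Opens X) :
    Function.Surjective (coverClass F V) :=
  Submodule.mkQ_surjective (LinearMap.range (coboundary F V))

/-- Linear maps out of the cohomology of a family. -/
def liftCoverH1 {ι : Type} (V : ι → Opens X) {M : Type} [AddCommGroup M] [Module ℂ M]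
    (f : cocycles F V →ₗ[ℂ] M) (hf : ∀ s, f (coboundary F V s) = 0) : CoverH1 F V →ₗ[ℂ] M :=
  Submodule.liftQ (LinearMap.range (coboundary F V)) f (by rintro _ ⟨s, rfl⟩; exact hf s)

/-- Restriction of cocycles to a refinement `W` of `V`, with refinement map `τ`. -/
def refineCocycle {ι κ : Type} (V : ι → Opens X) (W : κ → Opens X) (τ : κ → ι)
    (h : ∀ k, W k ≤ V (τ k)) : cocycles F V →ₗ[ℂ] cocycles F W where
  toFun g := ⟨fun k l => res F (inf_le_inf (h k) (h l)) (g.1 (τ k) (τ l)), by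
    intro i j k
    simp only [res_res]
    have := congrArg (res F (inf_le_inf (inf_le_inf (h i) (h j)) (h k)))
      (g.2 (τ i) (τ j) (τ k))
    simpa only [map_add, res_res] using this⟩
  map_add' a b := by
    ext i j
    simp
  map_smul' c a := by
    ext i j
    simp

/-- Restriction to a refinement, in cohomology. -/
def refineH1 {ι κ : Type} (V : ι → Opens X) (W : κ → Opens X) (τ : κ → ι)
    (h : ∀ k, W k ≤ V (τ k)) : CoverH1 F V →ₗ[ℂ] CoverH1 F W :=
  liftCoverH1 F V ((coverClass F W).comp (refineCocycle F V W τ h)) (by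
    intro f
    have : refineCocycle F V W τ h (coboundary F V f)
        = coboundary F W (fun k => res F (h k) (f (τ k))) := by
      ext i j
      simp only [coboundary, refineCocycle, LinearMap.coe_mk, AddHom.coe_mk, map_sub, res_res]
    rw [LinearMap.comp_apply, this, coverClass_coboundary])

/-- An open cover indexed by the points of the space, the set with index `x` containing `x`.
Every open cover has such a refinement. -/
@[ext]
structure PointedCover (X : Type) [TopologicalSpace X] where
  set : X → Opens X
  mem : ∀ x, x ∈ set x

/-- `U ≤ V` when `V` is finer than `U`. -/
instance : Preorder (PointedCover X) where
  le U V := ∀ x, V.set x ≤ U.set x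
  le_refl _ _ := le_rfl
  le_trans _ _ _ h h' x := (h' x).trans (h x)

open scoped Classical in
/-- The Čech cohomology `H¹(X, F)`: the direct limit, over all open covers ordered by refinement,
of the cohomology of the covers. -/
def H1 : Type :=
  Module.DirectLimit (R := ℂ) (fun U : PointedCover X => CoverH1 F U.set)
    (fun U V h => refineH1 F U.set V.set id h)

open scoped Classical in
instance : AddCommGroup (H1 F) :=
  Module.DirectLimit.addCommGroup (R := ℂ) (fun U : PointedCover X => CoverH1 F U.set)
    (fun U V h => refineH1 F U.set V.set id h)

open scoped Classical in
instance : Module ℂ (H1 F) :=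
  Module.DirectLimit.module (R := ℂ) (fun U : PointedCover X => CoverH1 F U.set)
    (fun U V h => refineH1 F U.set V.set id h)

open scoped Classical in
/-- The map to the direct limit. -/
def ofCover (U : PointedCover X) : CoverH1 F U.set →ₗ[ℂ] H1 F :=
  Module.DirectLimit.of ℂ (PointedCover X) (fun U : PointedCover X => CoverH1 F U.set)
    (fun U V h => refineH1 F U.set V.set id h) U

open scoped Classical in
lemma ofCover_refineH1 (U V : PointedCover X) (h : U ≤ V) (x : CoverH1 F U.set) :
    ofCover F V (refineH1 F U.set V.set id h x) = ofCover F U x :=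
  Module.DirectLimit.of_f (R := ℂ) (ι := PointedCover X)
    (G := fun U : PointedCover X => CoverH1 F U.set)
    (f := fun U V h => refineH1 F U.set V.set id h) (hij := h)

open scoped Classical in
/-- The universal property of the direct limit. -/
def liftH1 {M : Type} [AddCommGroup M] [Module ℂ M]
    (f : ∀ U : PointedCover X, CoverH1 F U.set →ₗ[ℂ] M)
    (hf : ∀ U V (h : U ≤ V) x, f V (refineH1 F U.set V.set id h x) = f U x) : H1 F →ₗ[ℂ] M :=
  Module.DirectLimit.lift ℂ (PointedCover X) (fun U : PointedCover X => CoverH1 F U.set)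
    (fun U V h => refineH1 F U.set V.set id h) f hf

/-- The class in `H¹(X, F)` of a cocycle of a pointed cover. -/
def pointedClass (U : PointedCover X) : cocycles F U.set →ₗ[ℂ] H1 F :=
  (ofCover F U).comp (coverClass F U.set)

lemma pointedClass_coboundary (U : PointedCover X) (f : ∀ x, Sec F (U.set x)) :
    pointedClass F U (coboundary F U.set f) = 0 := by
  rw [pointedClass, LinearMap.comp_apply, coverClass_coboundary, map_zero]

lemma pointedClass_refine (U V : PointedCover X) (h : U ≤ V) (g : cocycles F U.set) :
    pointedClass F V (refineCocycle F U.set V.set id h g) = pointedClass F U g :=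
  ofCover_refineH1 F U V h (coverClass F U.set g)

/-- A pointed refinement of an open cover. -/
def pointedRefinement {ι : Type} (V : ι → Opens X) (hV : ∀ x, ∃ i, x ∈ V i) : PointedCover X where
  set x := V (hV x).choose
  mem x := (hV x).choose_spec

/-- The class in `H¹(X, F)` of a Čech cocycle of an arbitrary open cover. -/
def cechClass {ι : Type} (V : ι → Opens X) (hV : ∀ x, ∃ i, x ∈ V i) :
    cocycles F V →ₗ[ℂ] H1 F :=
  (pointedClass F (pointedRefinement V hV)).comp
    (refineCocycle F V (pointedRefinement V hV).set (fun x => (hV x).choose) (fun _ => le_rfl))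

end Cech

section Functoriality

variable {X Y : Type} [TopologicalSpace X] [TopologicalSpace Y] (p : C(X, Y))
  (F : TopCat.Presheaf (ModuleCat.{0} ℂ) (TopCat.of Y))
  (G : TopCat.Presheaf (ModuleCat.{0} ℂ) (TopCat.of X))
  (φ : F ⟶ (TopCat.Presheaf.pushforward (ModuleCat.{0} ℂ) (TopCat.ofHom p)).obj G)

/-- The map on sections of a morphism of sheaves `F → p_* G`. -/
def secMap (U : Opens Y) : Sec F U →ₗ[ℂ] Sec G (Opens.comap p U) := (φ.app (op U)).hom

lemma secMap_res {U V : Opens Y} (h : V ≤ U) (s : Sec F U) :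
    secMap p F G φ V (res F h s)
      = res G (U := Opens.comap p U) (V := Opens.comap p V) (fun _ hx => h hx)
          (secMap p F G φ U s) :=
  congrArg (fun f => f.hom s) (φ.naturality (homOfLE (X := Opens (TopCat.of Y)) h).op)

/-- A morphism `F → p_* G` maps cocycles to cocycles of the inverse image family. -/
def mapCocycle {ι : Type} (V : ι → Opens Y) :
    cocycles F V →ₗ[ℂ] cocycles G (fun i => Opens.comap p (V i)) where
  toFun g := ⟨fun i j => secMap p F G φ (V i ⊓ V j) (g.1 i j), by
    intro i j k
    have := congrArg (secMap p F G φ (V i ⊓ V j ⊓ V k)) (g.2 i j k)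
    simp only [map_add, secMap_res] at this
    exact this⟩
  map_add' a b := by
    ext i j
    simp only [Submodule.coe_add, Pi.add_apply, map_add]
    rfl
  map_smul' c a := by
    ext i j
    simp only [SetLike.val_smul, Pi.smul_apply, map_smul]
    rfl

lemma mapCocycle_coboundary {ι : Type} (V : ι → Opens Y) (f : ∀ i, Sec F (V i)) :
    mapCocycle p F G φ V (coboundary F V f)
      = coboundary G (fun i => Opens.comap p (V i)) (fun i => secMap p F G φ (V i) (f i)) := by
  ext i j
  simp only [mapCocycle, coboundary, LinearMap.coe_mk, AddHom.coe_mk, map_sub, secMap_res]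
  rfl

/-- The inverse image of a pointed cover. -/
@[reducible] def PointedCover.comap (U : PointedCover Y) : PointedCover X where
  set x := Opens.comap p (U.set (p x))
  mem x := U.mem (p x)

/-- The effect of `mapH1` on cocycles of one pointed cover. -/
def mapPointedClass (U : PointedCover Y) : cocycles F U.set →ₗ[ℂ] H1 G :=
  (pointedClass G (U.comap p)).comp
    ((refineCocycle G (fun y => Opens.comap p (U.set y)) (U.comap p).set p
      (fun _ => le_rfl)).comp (mapCocycle p F G φ U.set))

lemma mapPointedClass_coboundary (U : PointedCover Y) (f : ∀ y, Sec F (U.set y)) :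
    mapPointedClass p F G φ U (coboundary F U.set f) = 0 := by
  rw [mapPointedClass, LinearMap.comp_apply, LinearMap.comp_apply, mapCocycle_coboundary]
  have : refineCocycle G (fun y => Opens.comap p (U.set y)) (U.comap p).set p
      (fun _ => le_rfl) (coboundary G (fun i => Opens.comap p (U.set i))
        (fun i => secMap p F G φ (U.set i) (f i)))
      = coboundary G (U.comap p).set (fun x => secMap p F G φ (U.set (p x)) (f (p x))) := by
    ext x y
    simp only [refineCocycle, coboundary, LinearMap.coe_mk, AddHom.coe_mk, map_sub, res_res]
  rw [this]
  exact pointedClass_coboundary G (U.comap p) _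

/-- The effect of `mapH1` on the cohomology of one pointed cover. -/
def mapCoverH1 (U : PointedCover Y) : CoverH1 F U.set →ₗ[ℂ] H1 G :=
  liftCoverH1 F U.set (mapPointedClass p F G φ U) (mapPointedClass_coboundary p F G φ U)

lemma mapCoverH1_refine (U V : PointedCover Y) (h : U ≤ V) (x : CoverH1 F U.set) :
    mapCoverH1 p F G φ V (refineH1 F U.set V.set id h x) = mapCoverH1 p F G φ U x := by
  obtain ⟨g, rfl⟩ := coverClass_surjective F U.set x
  have h' : U.comap p ≤ V.comap p := fun x _ hy => h (p x) hy
  have key : refineCocycle G (U.comap p).set (V.comap p).set id h'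
        (refineCocycle G (fun y => Opens.comap p (U.set y)) (U.comap p).set p
          (fun _ => le_rfl) (mapCocycle p F G φ U.set g))
      = refineCocycle G (fun y => Opens.comap p (V.set y)) (V.comap p).set p
          (fun _ => le_rfl) (mapCocycle p F G φ V.set
            (refineCocycle F U.set V.set id h g)) := by
    ext x y
    change res G _ (res G _ (secMap p F G φ (U.set (p x) ⊓ U.set (p y)) (g.1 (p x) (p y))))
      = res G _ (secMap p F G φ (V.set (p x) ⊓ V.set (p y))
          (res F (inf_le_inf (h (p x)) (h (p y))) (g.1 (p x) (p y))))
    rw [secMap_res]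
    exact (res_res G _ _ _).trans (res_res G _ _ _).symm
  change pointedClass G (V.comap p) (refineCocycle G (fun y => Opens.comap p (V.set y))
    (V.comap p).set p (fun _ => le_rfl) (mapCocycle p F G φ V.set
      (refineCocycle F U.set V.set id h g))) = _
  rw [← key]
  exact pointedClass_refine G _ _ h' _

/-- The map `H¹(Y, F) → H¹(X, G)` of a continuous map `p : X → Y` and a morphism `F → p_* G`: on
cocycles it is the application of the morphism. -/
def mapH1 : H1 F →ₗ[ℂ] H1 G :=
  liftH1 F (mapCoverH1 p F G φ) (mapCoverH1_refine p F G φ)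

end Functoriality

end Twistor
namespace Twistor

/-! ## The projective line, the total space of `O(2)` and the twistor space -/

/-- The quotient topology on a projective space. -/
instance projTopology {V : Type} [AddCommGroup V] [Module ℂ V] [TopologicalSpace V] :
    TopologicalSpace (ℙ ℂ V) :=
  inferInstanceAs (TopologicalSpace (Quotient (projectivizationSetoid ℂ V)))

/-- The projection from nonzero vectors to projective space. -/
def projMk (V : Type) [AddCommGroup V] [Module ℂ V] (v : {v : V // v ≠ 0}) : ℙ ℂ V :=
  Projectivization.mk ℂ v.1 v.2

lemma isQuotientMap_projMk {V : Type} [AddCommGroup V] [Module ℂ V] [TopologicalSpace V] :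
    Topology.IsQuotientMap (projMk V) := isQuotientMap_quot_mk

/-- The projective line. -/
abbrev P1 : Type := ℙ ℂ (Fin 2 → ℂ)

lemma rep_ne_zero_iff {n : ℕ} (v : Fin n → ℂ) (hv : v ≠ 0) (a : Fin n) :
    (Projectivization.mk ℂ v hv).rep a ≠ 0 ↔ v a ≠ 0 := by
  obtain ⟨c, hc⟩ := Projectivization.exists_smul_eq_mk_rep ℂ v hv
  rw [← hc]
  simp [Units.smul_def]

lemma isOpen_rep_ne_zero {n : ℕ} (a : Fin n) :
    IsOpen {p : ℙ ℂ (Fin n → ℂ) | p.rep a ≠ 0} := by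
  rw [← isQuotientMap_projMk.isOpen_preimage]
  have : projMk (Fin n → ℂ) ⁻¹' {p | p.rep a ≠ 0} = {v | v.1 a ≠ 0} := by
    ext v
    exact rep_ne_zero_iff v.1 v.2 a
  rw [this]
  exact isOpen_ne_fun ((continuous_apply a).comp continuous_subtype_val) continuous_const

/-- The open sets `U₀ = {z₀ ≠ 0}` and `U₁ = {z₁ ≠ 0}` of the projective line. -/
def P1.dom (a : Fin 2) : Opens P1 := ⟨{p | p.rep a ≠ 0}, isOpen_rep_ne_zero a⟩

lemma P1.mk_mem_dom {v : Fin 2 → ℂ} {hv : v ≠ 0} {a : Fin 2} :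
    Projectivization.mk ℂ v hv ∈ P1.dom a ↔ v a ≠ 0 := rep_ne_zero_iff v hv a

/-- The vector `(1, z)` for `a = 0` and `(z, 1)` for `a = 1`. -/
def homog (a : Fin 2) (z : ℂ) : Fin 2 → ℂ := if a = 0 then ![1, z] else ![z, 1]

lemma homog_self (a : Fin 2) (z : ℂ) : homog a z a = 1 := by
  fin_cases a <;> simp [homog]

lemma homog_other (a : Fin 2) (z : ℂ) : homog a z (a + 1) = z := by
  fin_cases a <;> simp [homog]

lemma homog_ne_zero (a : Fin 2) (z : ℂ) : homog a z ≠ 0 := fun h => by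
  have := homog_self a z
  simp [h] at this

lemma homog_div (a : Fin 2) (v : Fin 2 → ℂ) (h : v a ≠ 0) :
    v a • homog a (v (a + 1) / v a) = v := by
  ext i
  have h' : ∀ x : ℂ, v a * (x / v a) = x := fun x => by field_simp
  fin_cases a <;> fin_cases i
  · exact mul_one (v 0)
  · exact h' (v 1)
  · exact h' (v 0)
  · exact mul_one (v 1)

lemma continuous_homog (a : Fin 2) : Continuous (homog a) := by
  refine continuous_pi fun i => ?_
  fin_cases a <;> fin_cases i <;> simp [homog] <;> fun_prop

/-- `(z₀, z₁, w)` and `(c z₀, c z₁, c² w)` are the same point of the total space of `O(2)`. -/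
def totO2Setoid : Setoid {x : (Fin 2 → ℂ) × ℂ // x.1 ≠ 0} where
  r x y := ∃ c : ℂ, c ≠ 0 ∧ y.1.1 = c • x.1.1 ∧ y.1.2 = c ^ 2 * x.1.2
  iseqv :=
    { refl := fun x => ⟨1, one_ne_zero, by simp, by simp⟩
      symm := by
        rintro x y ⟨c, hc, h1, h2⟩
        refine ⟨c⁻¹, inv_ne_zero hc, ?_, ?_⟩
        · rw [h1, inv_smul_smul₀ hc]
        · rw [h2]; field_simp
      trans := by
        rintro x y z ⟨c, hc, h1, h2⟩ ⟨d, hd, h3, h4⟩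
        refine ⟨d * c, mul_ne_zero hd hc, ?_, ?_⟩
        · rw [h3, h1, smul_smul]
        · rw [h4, h2]; ring }

/-- The total space of the line bundle `O(2)` on the projective line: the point `[z₀, z₁; w]` is
the element of the fibre over `[z₀, z₁]` which, as a quadratic function on the line through
`(z₀, z₁)`, has the value `w` at `(z₀, z₁)`. -/
def TotO2 : Type := Quotient totO2Setoid

namespace TotO2

instance : TopologicalSpace TotO2 := inferInstanceAs (TopologicalSpace (Quotient totO2Setoid))

/-- The point `[v; w]`. -/
def mk (v : Fin 2 → ℂ) (w : ℂ) (hv : v ≠ 0) : TotO2 := Quotient.mk totO2Setoid ⟨(v, w), hv⟩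

/-- The quotient map. -/
def mk' (x : {x : (Fin 2 → ℂ) × ℂ // x.1 ≠ 0}) : TotO2 := mk x.1.1 x.1.2 x.2

lemma isQuotientMap_mk' : Topology.IsQuotientMap mk' := isQuotientMap_quot_mk

lemma ind {p : TotO2 → Prop} (h : ∀ v w hv, p (mk v w hv)) (x : TotO2) : p x :=
  Quotient.ind (fun a => h a.1.1 a.1.2 a.2) x

lemma mk_eq {v v' : Fin 2 → ℂ} {w w' : ℂ} {hv : v ≠ 0} {hv' : v' ≠ 0} {c : ℂ} (hc : c ≠ 0)
    (h : v' = c • v) (h' : w' = c ^ 2 * w) : mk v w hv = mk v' w' hv' :=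
  Quotient.sound (s := totO2Setoid) ⟨c, hc, h, h'⟩

/-- The value on `[v; w]` of a function of `(v, w)` with the right invariance. -/
def lift {α : Type} (f : (Fin 2 → ℂ) → ℂ → α)
    (hf : ∀ (v : Fin 2 → ℂ) (w c : ℂ), v ≠ 0 → c ≠ 0 → f (c • v) (c ^ 2 * w) = f v w)
    (x : TotO2) : α :=
  Quotient.lift (s := totO2Setoid) (fun x => f x.1.1 x.1.2) (by
    rintro ⟨⟨v, w⟩, hv⟩ ⟨⟨v', w'⟩, hv'⟩ ⟨c, hc, h1, h2⟩
    dsimp only at h1 h2 ⊢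
    rw [h1, h2, hf v w c hv hc]) x

lemma lift_mk {α : Type} (f : (Fin 2 → ℂ) → ℂ → α)
    (hf : ∀ (v : Fin 2 → ℂ) (w c : ℂ), v ≠ 0 → c ≠ 0 → f (c • v) (c ^ 2 * w) = f v w)
    (v : Fin 2 → ℂ) (w : ℂ) (hv : v ≠ 0) : lift f hf (mk v w hv) = f v w := rfl

/-- The bundle projection `[z₀, z₁; w] ↦ [z₀, z₁]`. -/
def proj : C(TotO2, P1) where
  toFun := Quotient.lift (s := totO2Setoid)
    (fun x => Projectivization.mk ℂ x.1.1 x.2) (by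
      rintro ⟨⟨v, w⟩, hv⟩ ⟨⟨v', w'⟩, hv'⟩ ⟨c, hc, h1, h2⟩
      exact ((Projectivization.mk_eq_mk_iff' ℂ _ _ _ _).2 ⟨c, h1.symm⟩).symm)
  continuous_toFun := by
    refine Continuous.quotient_lift (s := totO2Setoid) ?_ _
    exact isQuotientMap_projMk.continuous.comp
      (Continuous.subtype_mk (continuous_fst.comp continuous_subtype_val) fun x => x.2)

lemma proj_mk (v : Fin 2 → ℂ) (w : ℂ) (hv : v ≠ 0) :
    proj (mk v w hv) = Projectivization.mk ℂ v hv := rfl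

/-- The open sets `z₀ ≠ 0` and `z₁ ≠ 0` of the total space of `O(2)`. -/
def dom (a : Fin 2) : Opens TotO2 := Opens.comap proj (P1.dom a)

lemma mk_mem_dom {v : Fin 2 → ℂ} {w : ℂ} {hv : v ≠ 0} {a : Fin 2} :
    mk v w hv ∈ dom a ↔ v a ≠ 0 := P1.mk_mem_dom

lemma dom_cover (x : TotO2) : ∃ a, x ∈ dom a := by
  induction x using ind with
  | h v w hv =>
    by_contra! h
    simp only [mk_mem_dom, not_not] at h
    exact hv (funext h)

/-- The coordinates `(z₁ / z₀, w / z₀²)` for `a = 0` and `(z₀ / z₁, w / z₁²)` for `a = 1`. -/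
def coord (a : Fin 2) : TotO2 → ℂ × ℂ :=
  lift (fun v w => (v (a + 1) / v a, w / v a ^ 2)) (by
    intro v w c _ hc
    simp only [Pi.smul_apply, smul_eq_mul, mul_pow]
    rw [mul_div_mul_left _ _ hc, mul_div_mul_left _ _ (pow_ne_zero 2 hc)])

lemma coord_mk (a : Fin 2) (v : Fin 2 → ℂ) (w : ℂ) (hv : v ≠ 0) :
    coord a (mk v w hv) = (v (a + 1) / v a, w / v a ^ 2) := rfl

/-- The chart of the total space of `O(2)` on `{zₐ ≠ 0}`. -/
def chart (a : Fin 2) : OpenPartialHomeomorph TotO2 (ℂ × ℂ) where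
  toFun := coord a
  invFun y := mk (homog a y.1) y.2 (homog_ne_zero a y.1)
  source := dom a
  target := Set.univ
  map_source' _ _ := Set.mem_univ _
  map_target' y _ := by
    change mk _ _ _ ∈ dom a
    rw [mk_mem_dom, homog_self]
    exact one_ne_zero
  left_inv' x hx := by
    induction x using ind with
    | h v w hv =>
      have ha : v a ≠ 0 := mk_mem_dom.1 hx
      refine mk_eq ha (homog_div a v ha).symm ?_
      rw [coord_mk]
      field_simp
  right_inv' y _ := by
    rw [coord_mk, homog_self, homog_other]
    simp
  open_source := (dom a).isOpen
  open_target := isOpen_univ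
  continuousOn_toFun := by
    rw [isQuotientMap_mk'.continuousOn_isOpen_iff (dom a).isOpen]
    have h : ∀ x ∈ mk' ⁻¹' (dom a : Set TotO2), x.1.1 a ≠ 0 := fun x hx => mk_mem_dom.1 hx
    change ContinuousOn (fun x : {x : (Fin 2 → ℂ) × ℂ // x.1 ≠ 0} =>
      (x.1.1 (a + 1) / x.1.1 a, x.1.2 / x.1.1 a ^ 2)) _
    refine ContinuousOn.prodMk (ContinuousOn.div ?_ ?_ h)
      (ContinuousOn.div ?_ ?_ fun x hx => pow_ne_zero 2 (h x hx)) <;>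
    exact Continuous.continuousOn (by fun_prop)
  continuousOn_invFun := by
    refine Continuous.continuousOn ?_
    refine isQuotientMap_mk'.continuous.comp (Continuous.subtype_mk
      (f := fun y : ℂ × ℂ => (homog a y.1, y.2)) ?_ fun y => homog_ne_zero a y.1)
    exact ((continuous_homog a).comp continuous_fst).prodMk continuous_snd

instance : ChartedSpace (ℂ × ℂ) TotO2 where
  atlas := Set.range chart
  chartAt x := chart (dom_cover x).choose
  mem_chart_source x := (dom_cover x).choose_spec
  chart_mem_atlas _ := ⟨_, rfl⟩

lemma transition (a b : Fin 2) (hab : a ≠ b) (y : ℂ × ℂ) :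
    chart b ((chart a).symm y) = (1 / y.1, y.2 / y.1 ^ 2) := by
  change coord b (mk (homog a y.1) y.2 _) = _
  rw [coord_mk]
  fin_cases a <;> fin_cases b <;> simp [homog] at hab ⊢

/-- The two charts make the total space of `O(2)` a complex manifold. -/
instance : IsManifold 𝓘(ℂ, ℂ × ℂ) ω TotO2 := by
  refine isManifold_of_contDiffOn _ _ _ ?_
  rintro _ _ ⟨a, rfl⟩ ⟨b, rfl⟩
  by_cases hab : a = b
  · subst hab
    refine contDiffOn_id.congr fun y hy => ?_
    exact (chart a).right_inv (Set.mem_univ y)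
  · have hb : ∀ y ∈ (𝓘(ℂ, ℂ × ℂ).symm ⁻¹' ((chart a).symm.trans (chart b)).source ∩
        Set.range 𝓘(ℂ, ℂ × ℂ)), y.1 ≠ 0 := by
      rintro y ⟨hy, -⟩
      have hy' : mk (homog a y.1) y.2 (homog_ne_zero a y.1) ∈ dom b := hy.2
      rw [mk_mem_dom] at hy'
      fin_cases a <;> fin_cases b <;> simp [homog] at hab hy' ⊢ <;> exact hy'
    refine ContDiffOn.congr (f := fun y : ℂ × ℂ => (1 / y.1, y.2 / y.1 ^ 2)) ?_
      fun y hy => transition a b hab y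
    exact (contDiffOn_const.div contDiffOn_fst hb).prodMk
      (contDiffOn_snd.div (contDiffOn_fst.pow 2) fun y hy => pow_ne_zero 2 (hb y hy))

end TotO2

/-- The twistor space: the complement of the line `z₀ = z₁ = 0` in projective three-space. -/
def TwistorSpace : Type := {p : ℙ ℂ (Fin 4 → ℂ) // ¬ (p.rep 0 = 0 ∧ p.rep 1 = 0)}

namespace TwistorSpace

instance : TopologicalSpace TwistorSpace :=
  inferInstanceAs (TopologicalSpace {p : ℙ ℂ (Fin 4 → ℂ) // ¬ (p.rep 0 = 0 ∧ p.rep 1 = 0)})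

lemma rep_iff {v : Fin 4 → ℂ} {hv : v ≠ 0} :
    (¬ ((Projectivization.mk ℂ v hv).rep 0 = 0 ∧ (Projectivization.mk ℂ v hv).rep 1 = 0)) ↔
      ¬ (v 0 = 0 ∧ v 1 = 0) := by
  have h0 := rep_ne_zero_iff v hv 0
  have h1 := rep_ne_zero_iff v hv 1
  tauto

lemma ne_zero {v : Fin 4 → ℂ} (h : ¬ (v 0 = 0 ∧ v 1 = 0)) : v ≠ 0 := by
  rintro rfl
  simp at h

/-- The point `[z₀, z₁, z₂, z₃]`. -/
def mk (v : Fin 4 → ℂ) (h : ¬ (v 0 = 0 ∧ v 1 = 0)) : TwistorSpace :=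
  ⟨Projectivization.mk ℂ v (ne_zero h), rep_iff.2 h⟩

lemma ind {p : TwistorSpace → Prop} (h : ∀ v hv, p (mk v hv)) (x : TwistorSpace) : p x := by
  obtain ⟨x, hx⟩ := x
  induction x using Projectivization.ind with
  | h v hv => exact h v (rep_iff.1 hx)

lemma mk_eq {v v' : Fin 4 → ℂ} {hv : ¬ (v 0 = 0 ∧ v 1 = 0)} {hv' : ¬ (v' 0 = 0 ∧ v' 1 = 0)}
    (c : ℂ) (h : v' = c • v) : mk v hv = mk v' hv' :=
  Subtype.ext ((Projectivization.mk_eq_mk_iff' ℂ _ _ _ _).2 ⟨c, h.symm⟩).symm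

/-- The inclusion of the first two coordinates. -/
def emb : Fin 2 → Fin 4 := ![0, 1]

/-- The open sets `z₀ ≠ 0` and `z₁ ≠ 0` of the twistor space. -/
def dom (a : Fin 2) : Opens TwistorSpace :=
  ⟨{p | p.1.rep (emb a) ≠ 0}, (isOpen_rep_ne_zero (emb a)).preimage continuous_subtype_val⟩

lemma mk_mem_dom {v : Fin 4 → ℂ} {hv : ¬ (v 0 = 0 ∧ v 1 = 0)} {a : Fin 2} :
    mk v hv ∈ dom a ↔ v (emb a) ≠ 0 := rep_ne_zero_iff v (ne_zero hv) (emb a)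

lemma dom_cover (x : TwistorSpace) : ∃ a, x ∈ dom a := by
  induction x using ind with
  | h v hv =>
    by_contra! h
    simp only [mk_mem_dom, not_not] at h
    exact hv ⟨h 0, h 1⟩

/-- The affine coordinates of projective three-space on `zₐ ≠ 0`, as functions on the whole
projective space. -/
def projCoord (a : Fin 2) : ℙ ℂ (Fin 4 → ℂ) → ℂ × ℂ × ℂ :=
  Projectivization.lift
    (fun v => (v.1 (emb (a + 1)) / v.1 (emb a), v.1 2 / v.1 (emb a), v.1 3 / v.1 (emb a))) (by
    rintro ⟨v, hv⟩ ⟨w, hw⟩ c h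
    have hc : c ≠ 0 := by
      rintro rfl
      exact hv (by simpa using h)
    dsimp only at h ⊢
    subst h
    simp only [Pi.smul_apply, smul_eq_mul, mul_div_mul_left _ _ hc])

/-- The affine coordinates on `zₐ ≠ 0`: `(z₁ / z₀, z₂ / z₀, z₃ / z₀)` for `a = 0` and
`(z₀ / z₁, z₂ / z₁, z₃ / z₁)` for `a = 1`. -/
def coord (a : Fin 2) (p : TwistorSpace) : ℂ × ℂ × ℂ := projCoord a p.1

lemma coord_mk (a : Fin 2) (v : Fin 4 → ℂ) (hv : ¬ (v 0 = 0 ∧ v 1 = 0)) :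
    coord a (mk v hv)
      = (v (emb (a + 1)) / v (emb a), v 2 / v (emb a), v 3 / v (emb a)) := rfl

/-- The vector with given affine coordinates. -/
def vec (a : Fin 2) (y : ℂ × ℂ × ℂ) : Fin 4 → ℂ :=
  ![homog a y.1 0, homog a y.1 1, y.2.1, y.2.2]

lemma vec_emb (a b : Fin 2) (y : ℂ × ℂ × ℂ) : vec a y (emb b) = homog a y.1 b := by
  fin_cases b <;> rfl

lemma vec_ne (a : Fin 2) (y : ℂ × ℂ × ℂ) : ¬ (vec a y 0 = 0 ∧ vec a y 1 = 0) := by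
  rintro ⟨h0, h1⟩
  refine homog_ne_zero a y.1 (funext fun i => ?_)
  fin_cases i
  · exact h0
  · exact h1

/-- The affine chart of the twistor space on `{zₐ ≠ 0}`. -/
def chart (a : Fin 2) : OpenPartialHomeomorph TwistorSpace (ℂ × ℂ × ℂ) where
  toFun := coord a
  invFun y := mk (vec a y) (vec_ne a y)
  source := dom a
  target := Set.univ
  map_source' _ _ := Set.mem_univ _
  map_target' y _ := by
    change mk _ _ ∈ dom a
    rw [mk_mem_dom, vec_emb, homog_self]
    exact one_ne_zero
  left_inv' x hx := by
    induction x using ind with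
    | h v hv =>
      have ha : v (emb a) ≠ 0 := mk_mem_dom.1 hx
      refine mk_eq (v (emb a)) ?_
      have h := homog_div a (fun i => v (emb i)) ha
      rw [coord_mk]
      ext i
      fin_cases i
      · exact (congrFun h 0).symm
      · exact (congrFun h 1).symm
      · change v 2 = v (emb a) * (v 2 / v (emb a))
        field_simp
      · change v 3 = v (emb a) * (v 3 / v (emb a))
        field_simp
  right_inv' y _ := by
    rw [coord_mk, vec_emb, vec_emb, homog_self, homog_other]
    simp [vec]
  open_source := (dom a).isOpen
  open_target := isOpen_univ
  continuousOn_toFun := by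
    refine ContinuousOn.comp (g := projCoord a) (t := {p | p.rep (emb a) ≠ 0}) ?_
      continuous_subtype_val.continuousOn (fun x hx => hx)
    rw [isQuotientMap_projMk.continuousOn_isOpen_iff (isOpen_rep_ne_zero (emb a))]
    have h : ∀ x ∈ projMk (Fin 4 → ℂ) ⁻¹' {p | p.rep (emb a) ≠ 0}, x.1 (emb a) ≠ 0 :=
      fun x hx => (rep_ne_zero_iff x.1 x.2 (emb a)).1 hx
    change ContinuousOn (fun v : {v : Fin 4 → ℂ // v ≠ 0} =>
      (v.1 (emb (a + 1)) / v.1 (emb a), v.1 2 / v.1 (emb a), v.1 3 / v.1 (emb a))) _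
    refine ContinuousOn.prodMk (ContinuousOn.div ?_ ?_ h)
      (ContinuousOn.prodMk (ContinuousOn.div ?_ ?_ h) (ContinuousOn.div ?_ ?_ h)) <;>
    exact ((continuous_apply _).comp continuous_subtype_val).continuousOn
  continuousOn_invFun := by
    refine Continuous.continuousOn (Continuous.subtype_mk ?_ _)
    refine isQuotientMap_projMk.continuous.comp
      (Continuous.subtype_mk (f := vec a) ?_ fun y => ne_zero (vec_ne a y))
    have h : ∀ i, Continuous fun y : ℂ × ℂ × ℂ => homog a y.1 i := fun i =>
      (continuous_apply i).comp ((continuous_homog a).comp continuous_fst)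
    refine continuous_pi fun i => ?_
    fin_cases i
    · exact h 0
    · exact h 1
    · exact continuous_fst.comp continuous_snd
    · exact continuous_snd.comp continuous_snd

instance : ChartedSpace (ℂ × ℂ × ℂ) TwistorSpace where
  atlas := Set.range chart
  chartAt x := chart (dom_cover x).choose
  mem_chart_source x := (dom_cover x).choose_spec
  chart_mem_atlas _ := ⟨_, rfl⟩

lemma transition (a b : Fin 2) (hab : a ≠ b) (y : ℂ × ℂ × ℂ) :
    chart b ((chart a).symm y) = (1 / y.1, y.2.1 / y.1, y.2.2 / y.1) := by
  change coord b (mk (vec a y) (vec_ne a y)) = _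
  rw [coord_mk, vec_emb, vec_emb]
  fin_cases a <;> fin_cases b <;> simp [homog, vec] at hab ⊢

/-- The affine charts make the twistor space a complex manifold. -/
instance : IsManifold 𝓘(ℂ, ℂ × ℂ × ℂ) ω TwistorSpace := by
  refine isManifold_of_contDiffOn _ _ _ ?_
  rintro _ _ ⟨a, rfl⟩ ⟨b, rfl⟩
  by_cases hab : a = b
  · subst hab
    refine contDiffOn_id.congr fun y hy => ?_
    exact (chart a).right_inv (Set.mem_univ y)
  · have hb : ∀ y ∈ (𝓘(ℂ, ℂ × ℂ × ℂ).symm ⁻¹' ((chart a).symm.trans (chart b)).source ∩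
        Set.range 𝓘(ℂ, ℂ × ℂ × ℂ)), y.1 ≠ 0 := by
      rintro y ⟨hy, -⟩
      have hy' : mk (vec a y) (vec_ne a y) ∈ dom b := hy.2
      rw [mk_mem_dom, vec_emb] at hy'
      fin_cases a <;> fin_cases b <;> simp [homog] at hab hy' ⊢ <;> exact hy'
    refine ContDiffOn.congr (f := fun y : ℂ × ℂ × ℂ => (1 / y.1, y.2.1 / y.1, y.2.2 / y.1)) ?_
      fun y hy => transition a b hab y
    exact (contDiffOn_const.div contDiffOn_fst hb).prodMk
      ((contDiffOn_snd.fst.div contDiffOn_fst hb).prodMk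
        (contDiffOn_snd.snd.div contDiffOn_fst hb))

/-- The linear map `(z₀, z₁, z₂, z₃) ↦ (z₀, z₁, z₂ + t z₀, z₃ - t z₁)`. -/
def translate (t : ℂ) : (Fin 4 → ℂ) →ₗ[ℂ] (Fin 4 → ℂ) where
  toFun v := ![v 0, v 1, v 2 + t * v 0, v 3 - t * v 1]
  map_add' v w := by
    ext i
    fin_cases i <;> simp <;> ring
  map_smul' c v := by
    ext i
    fin_cases i <;> simp <;> ring

lemma translate_injective (t : ℂ) : Function.Injective (translate t) := by
  intro v w h
  have h0 : v 0 = w 0 := congrFun h 0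
  have h1 : v 1 = w 1 := congrFun h 1
  have h2 : v 2 + t * v 0 = w 2 + t * w 0 := congrFun h 2
  have h3 : v 3 - t * v 1 = w 3 - t * w 1 := congrFun h 3
  ext i
  fin_cases i
  · exact h0
  · exact h1
  · rw [h0] at h2
    exact add_right_cancel h2
  · rw [h1] at h3
    exact sub_left_injective h3

/-- The action of `ℂ` by translations,
`t +ᵥ [z₀, z₁, z₂, z₃] = [z₀, z₁, z₂ + t z₀, z₃ - t z₁]`. -/
instance : VAdd ℂ TwistorSpace where
  vadd t p := ⟨Projectivization.map (translate t) (translate_injective t) p.1, by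
    obtain ⟨p, hp⟩ := p
    induction p using Projectivization.ind with
    | h v hv =>
      rw [Projectivization.map_mk, rep_iff]
      exact rep_iff (hv := hv).1 hp⟩

lemma vadd_mk (t : ℂ) (v : Fin 4 → ℂ) (hv : ¬ (v 0 = 0 ∧ v 1 = 0)) :
    t +ᵥ mk v hv = mk ![v 0, v 1, v 2 + t * v 0, v 3 - t * v 1] hv := rfl

instance : AddAction ℂ TwistorSpace where
  zero_vadd x := by
    induction x using ind with
    | h v hv =>
      rw [vadd_mk]
      refine mk_eq 1 ?_
      ext i
      fin_cases i <;> simp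
  add_vadd s t x := by
    induction x using ind with
    | h v hv =>
      rw [vadd_mk, vadd_mk, vadd_mk s ![v 0, v 1, v 2 + t * v 0, v 3 - t * v 1] hv]
      refine mk_eq 1 ?_
      ext i
      fin_cases i <;> simp <;> ring

/-- The first two coordinates. -/
def base (v : Fin 4 → ℂ) : Fin 2 → ℂ := ![v 0, v 1]

lemma base_ne_zero {v : Fin 4 → ℂ} (h : ¬ (v 0 = 0 ∧ v 1 = 0)) : base v ≠ 0 :=
  fun h' => h ⟨congrFun h' 0, congrFun h' 1⟩

/-- The map `[z₀, z₁, z₂, z₃] ↦ [z₀, z₁; z₁ z₂ + z₃ z₀]` to the total space of `O(2)`. -/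
def quot (p : TwistorSpace) : TotO2 :=
  TotO2.mk (base p.1.rep) (p.1.rep 1 * p.1.rep 2 + p.1.rep 3 * p.1.rep 0) (base_ne_zero p.2)

lemma quot_mk (v : Fin 4 → ℂ) (hv : ¬ (v 0 = 0 ∧ v 1 = 0)) :
    quot (mk v hv) = TotO2.mk (base v) (v 1 * v 2 + v 3 * v 0) (base_ne_zero hv) := by
  obtain ⟨c, hc⟩ := Projectivization.exists_smul_eq_mk_rep ℂ v (ne_zero hv)
  refine (TotO2.mk_eq c.ne_zero ?_ ?_).symm
  · ext i
    fin_cases i <;> simp [mk, ← hc, base, Units.smul_def]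
  · simp only [mk, ← hc, Units.smul_def, Pi.smul_apply, smul_eq_mul]
    ring

end TwistorSpace

end Twistor
namespace Twistor

/-! ## Holomorphic functions and the twisting sheaves -/

section Holomorphic

variable {E : Type} [NormedAddCommGroup E] [NormedSpace ℂ E]
  (X : Type) [TopologicalSpace X] [ChartedSpace E X]

/-- The vector space of holomorphic functions on an open subset of a complex manifold. -/
def holoSub (U : Opens X) : Submodule ℂ (U → ℂ) where
  carrier := {f | ∃ g : X → ℂ, MDifferentiableOn 𝓘(ℂ, E) 𝓘(ℂ) g U ∧ ∀ x : U, f x = g x}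
  zero_mem' := ⟨fun _ => 0, mdifferentiableOn_const, fun _ => rfl⟩
  add_mem' := by
    rintro _ _ ⟨g, hg, h⟩ ⟨g', hg', h'⟩
    exact ⟨g + g', hg.add hg', fun x => congrArg₂ (· + ·) (h x) (h' x)⟩
  smul_mem' := by
    rintro c _ ⟨g, hg, h⟩
    exact ⟨c • g, hg.const_smul c, fun x => congrArg (c • ·) (h x)⟩

/-- The sheaf of holomorphic functions of a complex manifold. -/
def holo : TopCat.Presheaf (ModuleCat.{0} ℂ) (TopCat.of X) where
  obj U := ModuleCat.of ℂ (holoSub (E := E) X U.unop)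
  map {U V} i := ModuleCat.ofHom
    { toFun := fun f => ⟨fun x => f.1 ⟨x.1, i.unop.le x.2⟩, by
        obtain ⟨g, hg, h⟩ := f.2
        exact ⟨g, hg.mono i.unop.le, fun x => h _⟩⟩
      map_add' := fun _ _ => rfl
      map_smul' := fun _ _ => rfl }

variable {X}

/-- The function underlying a section of the sheaf of holomorphic functions. -/
def holoFun {U : Opens X} (f : Sec (holo (E := E) X) U) : U → ℂ :=
  (show holoSub (E := E) X U from f).1

end Holomorphic

/-- The set of nonzero vectors whose class lies in `U`. -/
def cone (U : Opens P1) : Set (Fin 2 → ℂ) := {v | ∃ hv : v ≠ 0, Projectivization.mk ℂ v hv ∈ U}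

/-- Homogeneity of degree `k` of a function on the cone over `U`. -/
def IsHomogOn (k : ℤ) (U : Opens P1) (s : (Fin 2 → ℂ) → ℂ) : Prop :=
  ∀ c : ℂ, c ≠ 0 → ∀ v ∈ cone U, s (c • v) = c ^ k * s v

/-- The sections of `O(k)` over an open subset `U` of the projective line: holomorphic functions on
the cone over `U` that are homogeneous of degree `k`. -/
def twistSub (k : ℤ) (U : Opens P1) : Submodule ℂ (cone U → ℂ) where
  carrier := {f | ∃ s : (Fin 2 → ℂ) → ℂ, DifferentiableOn ℂ s (cone U) ∧ IsHomogOn k U s ∧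
    ∀ v : cone U, f v = s v}
  zero_mem' := ⟨fun _ => 0, differentiableOn_const 0, fun c _ v _ => by simp, fun _ => rfl⟩
  add_mem' := by
    rintro _ _ ⟨g, hg, hk, h⟩ ⟨g', hg', hk', h'⟩
    refine ⟨g + g', hg.add hg', fun c hc v hv => ?_, fun x => congrArg₂ (· + ·) (h x) (h' x)⟩
    simp only [Pi.add_apply, hk c hc v hv, hk' c hc v hv, mul_add]
  smul_mem' := by
    rintro a _ ⟨g, hg, hk, h⟩
    refine ⟨a • g, hg.const_smul a, fun c hc v hv => ?_, fun x => congrArg (a • ·) (h x)⟩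
    simp only [Pi.smul_apply, smul_eq_mul, hk c hc v hv]
    ring

lemma cone_mono {U V : Opens P1} (h : V ≤ U) : cone V ⊆ cone U :=
  fun _ ⟨hv, hm⟩ => ⟨hv, h hm⟩

/-- The sheaf `O(k)` on the projective line. -/
def twist (k : ℤ) : TopCat.Presheaf (ModuleCat.{0} ℂ) (TopCat.of P1) where
  obj U := ModuleCat.of ℂ (twistSub k U.unop)
  map {U V} i := ModuleCat.ofHom
    { toFun := fun f => ⟨fun x => f.1 ⟨x.1, cone_mono i.unop.le x.2⟩, by
        obtain ⟨g, hg, hk, h⟩ := f.2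
        exact ⟨g, hg.mono (cone_mono i.unop.le),
          fun c hc v hv => hk c hc v (cone_mono i.unop.le hv), fun x => h _⟩⟩
      map_add' := fun _ _ => rfl
      map_smul' := fun _ _ => rfl }

/-- The homogeneous function underlying a section of `O(k)`. -/
def twistFun {k : ℤ} {U : Opens P1} (f : Sec (twist k) U) : cone U → ℂ :=
  (show twistSub k U from f).1

/-! ## Multiplication by the tautological section -/

namespace TotO2

/-- A representative of a point of the total space of `O(2)`. -/
def rep (x : TotO2) : {x : (Fin 2 → ℂ) × ℂ // x.1 ≠ 0} := Quotient.out x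

lemma mk_rep (x : TotO2) : mk x.rep.1.1 x.rep.1.2 x.rep.2 = x := Quotient.out_eq x

lemma rep_mk (v : Fin 2 → ℂ) (w : ℂ) (hv : v ≠ 0) :
    ∃ c : ℂ, c ≠ 0 ∧ (rep (mk v w hv)).1.1 = c • v ∧ (rep (mk v w hv)).1.2 = c ^ 2 * w := by
  obtain ⟨c, hc, h1, h2⟩ :=
    totO2Setoid.symm (Quotient.exact (s := totO2Setoid) (mk_rep (mk v w hv)))
  exact ⟨c, hc, h1, h2⟩

lemma rep_mem_cone {U : Opens P1} {x : TotO2} (hx : x ∈ Opens.comap proj U) :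
    x.rep.1.1 ∈ cone U := by
  refine ⟨x.rep.2, ?_⟩
  have h : proj x ∈ U := hx
  rw [← mk_rep x, proj_mk] at h
  exact h

/-- The function `[v; w] ↦ w s(v)` for a homogeneous function `s` of degree `-2`. -/
def tautFun (s : (Fin 2 → ℂ) → ℂ) (x : TotO2) : ℂ := x.rep.1.2 * s x.rep.1.1

lemma tautFun_mk {U : Opens P1} {s : (Fin 2 → ℂ) → ℂ} (hs : IsHomogOn (-2) U s)
    (v : Fin 2 → ℂ) (w : ℂ) (hv : v ≠ 0) (h : v ∈ cone U) :
    tautFun s (mk v w hv) = w * s v := by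
  obtain ⟨c, hc, h1, h2⟩ := rep_mk v w hv
  rw [tautFun, h1, h2, hs c hc v h]
  rw [zpow_neg]
  have : c ^ (2 : ℤ) = c ^ 2 := zpow_natCast c 2
  rw [this]
  field_simp

lemma isOpen_cone (U : Opens P1) : IsOpen (cone U) := by
  have h : cone U = Subtype.val '' (projMk (Fin 2 → ℂ) ⁻¹' (U : Set P1)) := by
    ext v
    constructor
    · rintro ⟨hv, hm⟩
      exact ⟨⟨v, hv⟩, hm, rfl⟩
    · rintro ⟨⟨v, hv⟩, hm, rfl⟩
      exact ⟨hv, hm⟩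
  rw [h]
  exact (isOpen_ne (x := (0 : Fin 2 → ℂ))).isOpenMap_subtype_val _
    (U.isOpen.preimage isQuotientMap_projMk.continuous)

lemma differentiable_homog (a : Fin 2) : Differentiable ℂ (homog a) := by
  refine differentiable_pi.2 fun i => ?_
  fin_cases a <;> fin_cases i <;> simp [homog]

lemma tautFun_holo {U : Opens P1} {s : (Fin 2 → ℂ) → ℂ} (hd : DifferentiableOn ℂ s (cone U))
    (hs : IsHomogOn (-2) U s) :
    MDifferentiableOn 𝓘(ℂ, ℂ × ℂ) 𝓘(ℂ) (tautFun s) (Opens.comap proj U) := by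
  intro x hx
  obtain ⟨a, ha⟩ := dom_cover x
  refine MDifferentiableAt.mdifferentiableWithinAt ?_
  have key : ∀ y ∈ dom a, y ∈ Opens.comap proj U →
      homog a (chart a y).1 ∈ cone U ∧
        tautFun s y = (chart a y).2 * s (homog a (chart a y).1) := by
    intro y hy hyU
    have e := (chart a).left_inv hy
    have hp : proj (mk (homog a (chart a y).1) (chart a y).2 (homog_ne_zero a _)) = proj y :=
      congrArg proj e
    have hc : homog a (chart a y).1 ∈ cone U := by
      refine ⟨homog_ne_zero a _, ?_⟩
      rw [← proj_mk _ (chart a y).2, hp]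
      exact hyU
    refine ⟨hc, ?_⟩
    rw [← tautFun_mk hs _ _ (homog_ne_zero a _) hc]
    exact congrArg (tautFun s) e.symm
  have hm : MDifferentiableAt 𝓘(ℂ, ℂ × ℂ) 𝓘(ℂ)
      ((fun z : ℂ × ℂ => z.2 * s (homog a z.1)) ∘ chart a) x := by
    have hc : chart a ∈ atlas (ℂ × ℂ) TotO2 := ⟨a, rfl⟩
    refine MDifferentiableAt.comp (I' := 𝓘(ℂ, ℂ × ℂ)) x ?_ (mdifferentiableAt_atlas hc ha)
    rw [mdifferentiableAt_iff_differentiableAt]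
    refine differentiableAt_snd.mul ?_
    exact DifferentiableAt.comp (chart a x)
      (hd.differentiableAt ((isOpen_cone U).mem_nhds (key x ha hx).1))
      ((differentiable_homog a _).comp (chart a x) differentiableAt_fst)
  refine hm.congr_of_eventuallyEq ?_
  filter_upwards [(dom a).isOpen.mem_nhds ha, (Opens.comap proj U).isOpen.mem_nhds hx]
    with y hy hyU
  exact (key y hy hyU).2

/-- Multiplication by the tautological section `w` of the pull-back of `O(2)`: the section `s` of
`O(-2)` over `U` is mapped to the function `[v; w] ↦ w s(v)` on the inverse image of `U`. -/
def mulTaut : twist (-2) ⟶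
    (TopCat.Presheaf.pushforward (ModuleCat.{0} ℂ) (TopCat.ofHom proj)).obj
      (holo (E := ℂ × ℂ) TotO2) where
  app U := ModuleCat.ofHom (X := twistSub (-2) U.unop)
    (Y := holoSub (E := ℂ × ℂ) TotO2 (Opens.comap proj U.unop))
    { toFun := fun f => ⟨fun x => x.1.rep.1.2 * f.1 ⟨x.1.rep.1.1, rep_mem_cone x.2⟩, by
        obtain ⟨s, hd, hs, h⟩ := f.2
        exact ⟨tautFun s, tautFun_holo hd hs, fun x => congrArg (x.1.rep.1.2 * ·) (h _)⟩⟩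
      map_add' := fun f g => Subtype.ext (funext fun x => mul_add _ _ _)
      map_smul' := fun c f => Subtype.ext (funext fun x => mul_left_comm _ _ _) }
  naturality U V i := rfl

/-- The product with the tautological section, `H¹(P¹, O(-2)) → H¹(O(2), O)`. -/
def mulTautH1 : H1 (twist (-2)) →ₗ[ℂ] H1 (holo (E := ℂ × ℂ) TotO2) :=
  mapH1 proj (twist (-2)) (holo (E := ℂ × ℂ) TotO2) mulTaut

lemma holoFun_mulTaut {U : Opens P1} (f : Sec (twist (-2)) U) (v : Fin 2 → ℂ) (w : ℂ) (hv : v ≠ 0)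
    (h : Projectivization.mk ℂ v hv ∈ U) :
    holoFun (E := ℂ × ℂ) (secMap proj (twist (-2)) (holo (E := ℂ × ℂ) TotO2) mulTaut U f)
      ⟨mk v w hv, h⟩ = w * twistFun f ⟨v, hv, h⟩ := by
  obtain ⟨s, hd, hs, h'⟩ := (show twistSub (-2) U from f).2
  have h1 := tautFun_mk hs v w hv ⟨hv, h⟩
  have h2 : twistFun f ⟨v, hv, h⟩ = s v := h' ⟨v, hv, h⟩
  rw [h2, ← h1]
  exact congrArg ((mk v w hv).rep.1.2 * ·) (h' ⟨(mk v w hv).rep.1.1, _⟩)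

end TotO2

/-! ## Principal bundles with group `ℂ` and their classes -/

section Principal

variable {E E' : Type} [NormedAddCommGroup E] [NormedSpace ℂ E] [NormedAddCommGroup E']
  [NormedSpace ℂ E'] {P X : Type} [TopologicalSpace P] [ChartedSpace E' P] [TopologicalSpace X]
  [ChartedSpace E X]

/-- `s` is a holomorphic section of `q` over `V`. -/
structure IsHoloSection (q : P → X) (V : Opens X) (s : X → P) : Prop where
  holo : MDifferentiableOn 𝓘(ℂ, E) 𝓘(ℂ, E') s V
  map_eq : ∀ u ∈ V, q (s u) = u

/-- `q : P → X` is a holomorphic principal bundle with structure group the additive group `ℂ`: the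
action is holomorphic, `q` is holomorphic and invariant, and near every point of `X` there is a
biholomorphic equivariant trivialization `V × ℂ → q⁻¹(V)`, `(u, t) ↦ t +ᵥ s u`, whose inverse is
`y ↦ (q y, τ y)`. -/
structure IsPrincipalBundle [AddAction ℂ P] (q : P → X) : Prop where
  holo_act : MDifferentiable (𝓘(ℂ).prod 𝓘(ℂ, E')) 𝓘(ℂ, E') (fun y : ℂ × P => y.1 +ᵥ y.2)
  holo_map : MDifferentiable 𝓘(ℂ, E') 𝓘(ℂ, E) q
  invariant : ∀ (t : ℂ) (y : P), q (t +ᵥ y) = q y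
  locally_trivial : ∀ x : X, ∃ (V : Opens X) (s : X → P) (τ : P → ℂ), x ∈ V ∧
    IsHoloSection (E := E) (E' := E') q V s ∧
    MDifferentiableOn 𝓘(ℂ, E') 𝓘(ℂ) τ (q ⁻¹' V) ∧
    (∀ u ∈ V, ∀ t : ℂ, τ (t +ᵥ s u) = t) ∧
    (∀ y, q y ∈ V → τ y +ᵥ s (q y) = y)

/-- `a` is the class in `H¹(X, O)` of the principal bundle `q : P → X`: for some open cover
`(V i)` and holomorphic sections `s i` over `V i`, it is the class of the cocycle `g` of the
translations that relate these sections, `g i j +ᵥ s i = s j`. -/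
def IsBundleClass [AddAction ℂ P] (q : P → X) (a : H1 (holo (E := E) X)) : Prop :=
  ∃ (ι : Type) (V : ι → Opens X) (hV : ∀ x, ∃ i, x ∈ V i) (s : ι → X → P)
    (g : cocycles (holo (E := E) X) V),
    (∀ i, IsHoloSection (E := E) (E' := E') q (V i) (s i)) ∧
    (∀ i j (u : (V i ⊓ V j : Opens X)), holoFun (g.1 i j) u +ᵥ s i u = s j u) ∧
    cechClass (holo (E := E) X) V hV g = a

end Principal

/-! ## The class of the standard `(1,1)`-form -/

/-- The Wirtinger derivative `∂f/∂z̄`. -/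
def dbar (f : ℂ → ℂ) (z : ℂ) : ℂ := (fderiv ℝ f z 1 + Complex.I * fderiv ℝ f z Complex.I) / 2

/-- The coefficient of the standard `(1,1)`-form `ω = dz ∧ dz̄ / (1 + z z̄)²` of the projective
line, in the affine coordinate `z = z₁ / z₀`. The form has the same coefficient in the affine
coordinate `u = z₀ / z₁ = 1 / z`. -/
def omegaCoeff (z : ℂ) : ℂ := 1 / (1 + z * starRingEnd ℂ z) ^ 2

/-- Under the isomorphism of `O(-2)` with the canonical bundle `K`, a smooth section of `O(-2)`
over `U`, that is, a smooth function `h` on the cone over `U` with `h (c v) = c⁻² h v`, is the smooth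
`(1,0)`-form `η = h · (z₀ dz₁ - z₁ dz₀)`, which is `h(1, z) dz` in the coordinate `z = z₁ / z₀` and
`-h(u, 1) du` in the coordinate `u = z₀ / z₁`. This predicate says that `∂̄η = ω` on `U`; here
`∂̄(f dz) = ∂f/∂z̄ dz̄ ∧ dz = -∂f/∂z̄ dz ∧ dz̄`. -/
structure IsOmegaPrimitive (U : Opens P1) (h : (Fin 2 → ℂ) → ℂ) : Prop where
  smooth : ContDiffOn ℝ ∞ h (cone U)
  homog : IsHomogOn (-2) U h
  dbar_zero : ∀ z : ℂ, ![1, z] ∈ cone U → -dbar (fun z => h ![1, z]) z = omegaCoeff z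
  dbar_one : ∀ u : ℂ, ![u, 1] ∈ cone U → -dbar (fun u => -h ![u, 1]) u = omegaCoeff u

/-- `b` is the class `[ω]` in `H¹(P¹, O(-2)) = H¹(P¹, K)` of the form `ω`, under the Dolbeault
isomorphism: for some open cover `(V i)` and smooth `(1,0)`-forms `h i` over `V i` with `∂̄ (h i) = ω`,
it is the class of the cocycle `h j - h i` of holomorphic `1`-forms. -/
def IsOmegaClass (b : H1 (twist (-2))) : Prop :=
  ∃ (ι : Type) (V : ι → Opens P1) (hV : ∀ x, ∃ i, x ∈ V i) (h : ι → (Fin 2 → ℂ) → ℂ)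
    (g : cocycles (twist (-2)) V),
    (∀ i, IsOmegaPrimitive (V i) (h i)) ∧
    (∀ i j (v : cone (V i ⊓ V j)), twistFun (g.1 i j) v = h j v - h i v) ∧
    cechClass (twist (-2)) V hV g = b

end Twistor

end

/-!
The map `quot` is trivialized over `{z₀ ≠ 0}` and `{z₁ ≠ 0}` by the sections
`[z₀, z₁; w] ↦ [z₀, z₁, 0, w / z₀]` and `[z₀, z₁; w] ↦ [z₀, z₁, w / z₁, 0]` (`sect`), whose fibre
coordinates are `z₂ / z₀` and `-z₃ / z₁`. The translation from the first section to the second is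
by `w / (z₀ z₁)`, which is therefore a cocycle for the class of the bundle.

On the projective line the form `ω` has the primitives `-z̄₁ / (z₀ (|z₀|² + |z₁|²))` over
`{z₀ ≠ 0}` and `z̄₀ / (z₁ (|z₀|² + |z₁|²))` over `{z₁ ≠ 0}`, written as homogeneous functions of
degree `-2` (`primitive`). Their difference is `1 / (z₀ z₁)`, so the product of the tautological
section `w` with the class of `ω` is represented by `w / (z₀ z₁)` too, and the constant relating the
two classes is `1`.

Both classes must be shown independent of the covers and local data that define them. Two
holomorphic sections of a principal bundle differ by a holomorphic function
(`IsPrincipalBundle.exists_translation`), and two primitives of `ω` differ by a holomorphic section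
of `O(-2)`, by the Cauchy-Riemann equations (`IsOmegaPrimitive.exists_sub`). For two families of
local data these differences form a cochain whose coboundary is the difference of the two cocycles,
and `cechClass_eq_of_sub` says that the classes in the direct limit then agree. That
multiplication by `w` may be computed on the cover `{U₀, U₁}` is `mapH1_cechClass`.
-/

noncomputable section

namespace Twistor

/-! ### Čech classes of arbitrary open covers -/

section Cech

variable {X : Type} [TopologicalSpace X] (F : TopCat.Presheaf (ModuleCat.{0} ℂ) (TopCat.of X))

lemma res_cocycle_add {ι : Type} {V : ι → Opens X} (g : cocycles F V) {i j k : ι} {U : Opens X}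
    (hi : U ≤ V i) (hj : U ≤ V j) (hk : U ≤ V k) :
    res F (le_inf hi hj) (g.1 i j) + res F (le_inf hj hk) (g.1 j k)
      = res F (le_inf hi hk) (g.1 i k) := by
  have := congrArg (res F (le_inf (le_inf hi hj) hk)) (g.2 i j k)
  simpa only [map_add, res_res] using this

/-- If `g' - g` is the coboundary of a family `f i j` over the sets `V i ⊓ V' j`, then refinements
of `g` and `g'` to pointed covers `W` and `W'` have the same class: on the common refinement
`W x ⊓ W' x` they differ by the coboundary of the sections `f (τ x) (σ x)`. -/
lemma pointedClass_eq_of_sub {ι κ : Type} {V : ι → Opens X} {V' : κ → Opens X}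
    (W W' : PointedCover X) (τ : X → ι) (hτ : ∀ x, W.set x ≤ V (τ x)) (σ : X → κ)
    (hσ : ∀ x, W'.set x ≤ V' (σ x)) (g : cocycles F V) (g' : cocycles F V')
    (f : ∀ i j, Sec F (V i ⊓ V' j))
    (hf : ∀ i j i' j' (U : Opens X) (hi : U ≤ V i) (hj : U ≤ V' j) (hi' : U ≤ V i')
      (hj' : U ≤ V' j'),
      res F (le_inf hj hj') (g'.1 j j') - res F (le_inf hi hi') (g.1 i i')
        = res F (le_inf hi' hj') (f i' j') - res F (le_inf hi hj) (f i j)) :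
    pointedClass F W (refineCocycle F V W.set τ hτ g)
      = pointedClass F W' (refineCocycle F V' W'.set σ hσ g') := by
  let W'' : PointedCover X := ⟨fun x => W.set x ⊓ W'.set x, fun x => ⟨W.mem x, W'.mem x⟩⟩
  have h : W ≤ W'' := fun x => inf_le_left
  have h' : W' ≤ W'' := fun x => inf_le_right
  rw [← pointedClass_refine F W W'' h, ← pointedClass_refine F W' W'' h']
  refine (sub_eq_zero.1 ?_).symm
  rw [← map_sub, ← pointedClass_coboundary F W'' fun x =>
    res F (inf_le_inf (hτ x) (hσ x)) (f (τ x) (σ x))]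
  congr 1
  ext x y
  change res F _ (res F _ (g'.1 (σ x) (σ y))) - res F _ (res F _ (g.1 (τ x) (τ y)))
    = res F _ (res F _ (f (τ y) (σ y))) - res F _ (res F _ (f (τ x) (σ x)))
  simp only [res_res]
  have hx : W''.set x ⊓ W''.set y ≤ W''.set x := inf_le_left
  have hy : W''.set x ⊓ W''.set y ≤ W''.set y := inf_le_right
  exact hf _ _ _ _ _ (hx.trans (inf_le_left.trans (hτ x))) (hx.trans (inf_le_right.trans (hσ x)))
    (hy.trans (inf_le_left.trans (hτ y))) (hy.trans (inf_le_right.trans (hσ y)))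

/-- The class of a cocycle may be computed on any pointed refinement, with any refinement map: the
cocycle itself bounds the difference of two of its refinements. -/
lemma pointedClass_refineCocycle {ι : Type} (V : ι → Opens X) (hV : ∀ x, ∃ i, x ∈ V i)
    (W : PointedCover X) (τ : X → ι) (hτ : ∀ x, W.set x ≤ V (τ x)) (g : cocycles F V) :
    pointedClass F W (refineCocycle F V W.set τ hτ g) = cechClass F V hV g := by
  refine pointedClass_eq_of_sub F W _ τ hτ _ _ g g (fun i j => g.1 i j) ?_
  intro i j i' j' U hi hj hi' hj'
  have h1 := res_cocycle_add F g hi hj hj'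
  have h2 := res_cocycle_add F g hi hi' hj'
  rw [sub_eq_sub_iff_add_eq_add, add_comm, h1, add_comm, h2]

/-- Cocycles `g`, `g'` of two covers `V`, `V'` have the same class if `g' - g` is the coboundary of
a family of sections over the sets `V i ⊓ V' j`. -/
lemma cechClass_eq_of_sub {ι κ : Type} {V : ι → Opens X} {V' : κ → Opens X}
    (hV : ∀ x, ∃ i, x ∈ V i) (hV' : ∀ x, ∃ i, x ∈ V' i) (g : cocycles F V) (g' : cocycles F V')
    (f : ∀ i j, Sec F (V i ⊓ V' j))
    (hf : ∀ i j i' j' (U : Opens X) (hi : U ≤ V i) (hj : U ≤ V' j) (hi' : U ≤ V i')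
      (hj' : U ≤ V' j'),
      res F (le_inf hj hj') (g'.1 j j') - res F (le_inf hi hi') (g.1 i i')
        = res F (le_inf hi' hj') (f i' j') - res F (le_inf hi hj) (f i j)) :
    cechClass F V hV g = cechClass F V' hV' g' :=
  pointedClass_eq_of_sub F _ _ _ _ _ _ g g' f hf

end Cech

section Functoriality

variable {X Y : Type} [TopologicalSpace X] [TopologicalSpace Y] (p : C(X, Y))
  (F : TopCat.Presheaf (ModuleCat.{0} ℂ) (TopCat.of Y))
  (G : TopCat.Presheaf (ModuleCat.{0} ℂ) (TopCat.of X))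
  (φ : F ⟶ (TopCat.Presheaf.pushforward (ModuleCat.{0} ℂ) (TopCat.ofHom p)).obj G)

lemma mapH1_pointedClass (U : PointedCover Y) (g : cocycles F U.set) :
    mapH1 p F G φ (pointedClass F U g) = mapPointedClass p F G φ U g := by
  classical
  exact Module.DirectLimit.lift_of (R := ℂ) (ι := PointedCover Y)
    (G := fun U : PointedCover Y => CoverH1 F U.set)
    (f := fun U V h => refineH1 F U.set V.set id h) _ (mapCoverH1_refine p F G φ) _

/-- The map in cohomology applies the morphism of sheaves to cocycles of any cover. -/
lemma mapH1_cechClass {ι : Type} (V : ι → Opens Y) (hV : ∀ y, ∃ i, y ∈ V i) (g : cocycles F V) :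
    mapH1 p F G φ (cechClass F V hV g)
      = cechClass G (fun i => Opens.comap p (V i)) (fun x => hV (p x))
          (mapCocycle p F G φ V g) := by
  rw [cechClass, LinearMap.comp_apply, mapH1_pointedClass,
    ← pointedClass_refineCocycle G (fun i => Opens.comap p (V i)) (fun x => hV (p x))
      ((pointedRefinement V hV).comap p) (fun x => (hV (p x)).choose) (fun _ => le_rfl),
    mapPointedClass, LinearMap.comp_apply]
  congr 1
  ext x y
  exact (congrArg (res G _) (secMap_res p F G φ (inf_le_inf le_rfl le_rfl)
    (g.1 (hV (p x)).choose (hV (p y)).choose))).trans (res_res G _ _ _)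

end Functoriality

/-! ### The class of a holomorphic principal bundle -/

section Principal

variable {E E' : Type} [NormedAddCommGroup E] [NormedSpace ℂ E] [NormedAddCommGroup E']
  [NormedSpace ℂ E'] {P X : Type} [TopologicalSpace P] [ChartedSpace E' P] [TopologicalSpace X]
  [ChartedSpace E X]

lemma holo_ext {U : Opens X} {f g : Sec (holo (E := E) X) U}
    (h : ∀ u, holoFun f u = holoFun g u) : f = g :=
  Subtype.ext (funext h)

lemma holoFun_res {U V : Opens X} (h : V ≤ U) (f : Sec (holo (E := E) X) U) (u : V) :
    holoFun (res (holo (E := E) X) h f) u = holoFun f ⟨u.1, h u.2⟩ := rfl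

lemma holoFun_sub {U : Opens X} (f g : Sec (holo (E := E) X) U) (u : U) :
    holoFun (f - g) u = holoFun f u - holoFun g u := rfl

variable {q : P → X}

lemma IsHoloSection.mono {V W : Opens X} {s : X → P}
    (hs : IsHoloSection (E := E) (E' := E') q V s) (h : W ≤ V) :
    IsHoloSection (E := E) (E' := E') q W s :=
  ⟨hs.holo.mono h, fun u hu => hs.map_eq u (h hu)⟩

variable [AddAction ℂ P]

/-- The action on the total space of a principal bundle is free. -/
lemma IsPrincipalBundle.vadd_right_injective (hq : IsPrincipalBundle (E := E) (E' := E') q)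
    (y : P) : Function.Injective fun t : ℂ => t +ᵥ y := by
  intro t t' (h : t +ᵥ y = t' +ᵥ y)
  obtain ⟨V, s, τ, hx, -, -, h1, h2⟩ := hq.locally_trivial (q y)
  have hτ : ∀ a : ℂ, τ (a +ᵥ y) = a + τ y := fun a => by
    conv_lhs => rw [← h2 y hx, vadd_vadd]
    exact h1 _ hx _
  have := congrArg τ h
  rw [hτ, hτ] at this
  exact add_right_cancel this

/-- Two holomorphic sections of a principal bundle differ by the action of a holomorphic
function, which is the difference of their fibre coordinates in any local trivialization. -/
lemma IsPrincipalBundle.exists_translation (hq : IsPrincipalBundle (E := E) (E' := E') q)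
    {V : Opens X} {s s' : X → P} (hs : IsHoloSection (E := E) (E' := E') q V s)
    (hs' : IsHoloSection (E := E) (E' := E') q V s') :
    ∃ f : Sec (holo (E := E) X) V, ∀ u : V, holoFun f u +ᵥ s u = s' u := by
  have hloc : ∀ u ∈ V, ∃ (W : Opens X) (τ : P → ℂ), u ∈ W ∧
      MDifferentiableOn 𝓘(ℂ, E') 𝓘(ℂ) τ (q ⁻¹' W) ∧
      ∀ v ∈ W, v ∈ V → (τ (s' v) - τ (s v)) +ᵥ s v = s' v := by
    intro u hu
    obtain ⟨W, σ, τ, hx, -, hτ, -, h2⟩ := hq.locally_trivial u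
    refine ⟨W, τ, hx, hτ, fun v hv hvV => ?_⟩
    have e1 := h2 (s v) (by rwa [hs.map_eq v hvV])
    have e2 := h2 (s' v) (by rwa [hs'.map_eq v hvV])
    rw [hs.map_eq v hvV] at e1
    rw [hs'.map_eq v hvV] at e2
    conv_lhs => rw [← e1, vadd_vadd, e1, sub_add_cancel]
    exact e2
  have hex : ∀ u, ∃ t : ℂ, u ∈ V → t +ᵥ s u = s' u := fun u => by
    by_cases hu : u ∈ V
    · obtain ⟨W, τ, hx, -, h⟩ := hloc u hu
      exact ⟨_, fun _ => h u hx hu⟩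
    · exact ⟨0, fun h => absurd h hu⟩
  choose f hf using hex
  have hd : MDifferentiableOn 𝓘(ℂ, E) 𝓘(ℂ) f V := by
    intro u hu
    obtain ⟨W, τ, hx, hτ, h⟩ := hloc u hu
    have hsec : ∀ {r : X → P}, IsHoloSection (E := E) (E' := E') q V r →
        MDifferentiableWithinAt 𝓘(ℂ, E) 𝓘(ℂ) (fun v => τ (r v)) (V ⊓ W : Opens X) u := by
      intro r hr
      refine MDifferentiableWithinAt.comp u (hτ (r u) ?_)
        ((hr.holo u hu).mono fun v hv => hv.1) fun v hv => ?_
      · change q (r u) ∈ W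
        rwa [hr.map_eq u hu]
      · change q (r v) ∈ W
        rw [hr.map_eq v hv.1]
        exact hv.2
    have hm : MDifferentiableWithinAt 𝓘(ℂ, E) 𝓘(ℂ) f (V ⊓ W : Opens X) u := by
      refine ((hsec hs').sub (hsec hs)).congr (fun v hv => ?_) ?_
      · exact hq.vadd_right_injective (s v) ((hf v hv.1).trans (h v hv.2 hv.1).symm)
      · exact hq.vadd_right_injective (s u) ((hf u hu).trans (h u hx hu).symm)
    exact (hm.mdifferentiableAt ((V ⊓ W).isOpen.mem_nhds ⟨hu, hx⟩)).mdifferentiableWithinAt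
  exact ⟨⟨fun u => f u, f, hd, fun _ => rfl⟩, fun u => hf u u.2⟩

/-- The class of a principal bundle is independent of the cover and of the local sections: the
translations between two families of sections bound the difference of their cocycles. -/
lemma IsPrincipalBundle.bundleClass_unique (hq : IsPrincipalBundle (E := E) (E' := E') q)
    {a b : H1 (holo (E := E) X)} (ha : IsBundleClass (E' := E') q a)
    (hb : IsBundleClass (E' := E') q b) : a = b := by
  obtain ⟨ι, V, hV, s, g, hs, hg, rfl⟩ := ha
  obtain ⟨κ, V', hV', s', g', hs', hg', rfl⟩ := hb
  choose f hf using fun i j =>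
    hq.exists_translation ((hs i).mono (inf_le_left : V i ⊓ V' j ≤ V i)) ((hs' j).mono inf_le_right)
  refine cechClass_eq_of_sub _ hV hV' g g' f fun i j i' j' U hi hj hi' hj' => holo_ext fun u => ?_
  simp only [holoFun_sub, holoFun_res]
  have e1 := hg i i' ⟨u, hi u.2, hi' u.2⟩
  have e2 := hg' j j' ⟨u, hj u.2, hj' u.2⟩
  have e3 := hf i j ⟨u, hi u.2, hj u.2⟩
  have e4 := hf i' j' ⟨u, hi' u.2, hj' u.2⟩
  dsimp only at e1 e2 e3 e4
  rw [sub_eq_sub_iff_add_eq_add]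
  refine hq.vadd_right_injective (s i u) ?_
  change (_ + _) +ᵥ _ = (_ + _) +ᵥ _
  rw [add_vadd, e3, e2, add_vadd, e1, e4]

end Principal

/-! ### The twistor space as a principal bundle over the total space of `O(2)` -/

namespace TotO2

lemma mdifferentiableAt_chart {a : Fin 2} {x : TotO2} (hx : x ∈ dom a) :
    MDifferentiableAt 𝓘(ℂ, ℂ × ℂ) 𝓘(ℂ, ℂ × ℂ) (coord a) x :=
  mdifferentiableAt_atlas (e := chart a) (Set.mem_range_self a) hx

lemma mdifferentiable_chart_symm (a : Fin 2) :
    MDifferentiable 𝓘(ℂ, ℂ × ℂ) 𝓘(ℂ, ℂ × ℂ) (chart a).symm := fun y =>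
  mdifferentiableAt_atlas_symm (e := chart a) (Set.mem_range_self a) (Set.mem_univ y)

end TotO2

namespace TwistorSpace

lemma mdifferentiableAt_chart {a : Fin 2} {x : TwistorSpace} (hx : x ∈ dom a) :
    MDifferentiableAt 𝓘(ℂ, ℂ × ℂ × ℂ) 𝓘(ℂ, ℂ × ℂ × ℂ) (coord a) x :=
  mdifferentiableAt_atlas (e := chart a) (Set.mem_range_self a) hx

lemma mdifferentiable_chart_symm (a : Fin 2) :
    MDifferentiable 𝓘(ℂ, ℂ × ℂ × ℂ) 𝓘(ℂ, ℂ × ℂ × ℂ) (chart a).symm := fun y =>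
  mdifferentiableAt_atlas_symm (e := chart a) (Set.mem_range_self a) (Set.mem_univ y)

lemma chart_symm_apply (a : Fin 2) (y : ℂ × ℂ × ℂ) :
    (chart a).symm y = mk (vec a y) (vec_ne a y) :=
  rfl

lemma chart_symm_coord {a : Fin 2} {x : TwistorSpace} (hx : x ∈ dom a) :
    (chart a).symm (coord a x) = x := (chart a).left_inv hx

lemma quot_mem_dom {a : Fin 2} {x : TwistorSpace} : quot x ∈ TotO2.dom a ↔ x ∈ dom a := by
  induction x using ind with
  | h v hv =>
    rw [quot_mk, TotO2.mk_mem_dom, mk_mem_dom]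
    fin_cases a <;> rfl

/-- The holomorphic section `[z₀, z₁; w] ↦ [z₀, z₁, 0, w / z₀]` over `{z₀ ≠ 0}` for `a = 0`, and
`[z₀, z₁; w] ↦ [z₀, z₁, w / z₁, 0]` over `{z₁ ≠ 0}` for `a = 1`. -/
def sect (a : Fin 2) (x : TotO2) : TwistorSpace :=
  (chart a).symm ((TotO2.coord a x).1,
    if a = 0 then (0, (TotO2.coord a x).2) else ((TotO2.coord a x).2, 0))

lemma sect_zero (v : Fin 2 → ℂ) (w : ℂ) (hv : v ≠ 0) (h : v 0 ≠ 0) :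
    sect 0 (TotO2.mk v w hv) = mk ![v 0, v 1, 0, w / v 0] fun h' => h h'.1 := by
  refine mk_eq (hv := vec_ne 0 _) (v 0) ?_
  ext i
  fin_cases i <;> simp [vec, homog, TotO2.coord_mk] <;> field_simp

lemma sect_one (v : Fin 2 → ℂ) (w : ℂ) (hv : v ≠ 0) (h : v 1 ≠ 0) :
    sect 1 (TotO2.mk v w hv) = mk ![v 0, v 1, w / v 1, 0] fun h' => h h'.2 := by
  refine mk_eq (hv := vec_ne 1 _) (v 1) ?_
  ext i
  fin_cases i <;> simp [vec, homog, TotO2.coord_mk] <;> field_simp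

/-- The fibre coordinate of the trivialization by `sect a`: `z₂ / z₀` for `a = 0` and `-z₃ / z₁` for
`a = 1`. -/
def fibreCoord (a : Fin 2) (x : TwistorSpace) : ℂ :=
  if a = 0 then (coord a x).2.1 else -(coord a x).2.2

lemma quot_chart_symm (a : Fin 2) (y : ℂ × ℂ × ℂ) :
    quot ((chart a).symm y) = (TotO2.chart a).symm
      (y.1, if a = 0 then y.1 * y.2.1 + y.2.2 else y.2.1 + y.1 * y.2.2) := by
  rw [chart_symm_apply, quot_mk]
  refine TotO2.mk_eq one_ne_zero ?_ ?_
  · ext i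
    fin_cases i <;> simp [base, vec]
  · fin_cases a <;> simp [vec, homog, mul_comm]

lemma vadd_chart_symm (a : Fin 2) (t : ℂ) (y : ℂ × ℂ × ℂ) :
    t +ᵥ (chart a).symm y = (chart a).symm
      (y.1, if a = 0 then (y.2.1 + t, y.2.2 - t * y.1) else (y.2.1 + t * y.1, y.2.2 - t)) := by
  rw [chart_symm_apply, chart_symm_apply, vadd_mk]
  refine mk_eq 1 ?_
  ext i
  fin_cases a <;> fin_cases i <;> simp [vec, homog]

lemma mdifferentiable_quot :
    MDifferentiable 𝓘(ℂ, ℂ × ℂ × ℂ) 𝓘(ℂ, ℂ × ℂ) quot := by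
  intro x
  obtain ⟨a, ha⟩ := dom_cover x
  have h : Differentiable ℂ fun y : ℂ × ℂ × ℂ =>
      (y.1, if a = 0 then y.1 * y.2.1 + y.2.2 else y.2.1 + y.1 * y.2.2) := by
    split_ifs <;> fun_prop
  refine (((TotO2.mdifferentiable_chart_symm a _).comp (I' := 𝓘(ℂ, ℂ × ℂ)) x
    ((h _).mdifferentiableAt.comp (I' := 𝓘(ℂ, ℂ × ℂ × ℂ)) x
      (mdifferentiableAt_chart ha)))).congr_of_eventuallyEq ?_
  filter_upwards [(dom a).isOpen.mem_nhds ha] with y hy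
  exact (congrArg quot (chart_symm_coord hy).symm).trans (quot_chart_symm a _)

lemma mdifferentiable_vadd :
    MDifferentiable (𝓘(ℂ).prod 𝓘(ℂ, ℂ × ℂ × ℂ)) 𝓘(ℂ, ℂ × ℂ × ℂ)
      (fun y : ℂ × TwistorSpace => y.1 +ᵥ y.2) := by
  rintro ⟨t, x⟩
  obtain ⟨a, ha⟩ := dom_cover x
  have h : Differentiable ℂ fun y : ℂ × ℂ × ℂ × ℂ => ((y.2.1,
      if a = 0 then (y.2.2.1 + y.1, y.2.2.2 - y.1 * y.2.1)
        else (y.2.2.1 + y.1 * y.2.1, y.2.2.2 - y.1)) : ℂ × ℂ × ℂ) := by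
    split_ifs <;> fun_prop
  have hc : MDifferentiableAt (𝓘(ℂ).prod 𝓘(ℂ, ℂ × ℂ × ℂ)) 𝓘(ℂ, ℂ × ℂ × ℂ × ℂ)
      (fun y : ℂ × TwistorSpace => (y.1, coord a y.2)) (t, x) :=
    mdifferentiableAt_fst.prodMk_space
      (MDifferentiableAt.comp (I' := 𝓘(ℂ, ℂ × ℂ × ℂ)) (g := coord a) (t, x)
        (mdifferentiableAt_chart ha) mdifferentiableAt_snd)
  refine ((mdifferentiable_chart_symm a _).comp (I' := 𝓘(ℂ, ℂ × ℂ × ℂ)) (t, x)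
    ((h _).mdifferentiableAt.comp (I' := 𝓘(ℂ, ℂ × ℂ × ℂ × ℂ)) (t, x) hc)).congr_of_eventuallyEq ?_
  filter_upwards [((dom a).isOpen.preimage continuous_snd).mem_nhds ha] with y hy
  exact (congrArg (y.1 +ᵥ ·) (chart_symm_coord hy).symm).trans (vadd_chart_symm a _ _)

lemma isHoloSection_sect (a : Fin 2) :
    IsHoloSection (E := ℂ × ℂ) (E' := ℂ × ℂ × ℂ) quot (TotO2.dom a) (sect a) where
  holo x hx := by
    have h : Differentiable ℂ fun y : ℂ × ℂ =>
        ((y.1, if a = 0 then (0, y.2) else (y.2, 0)) : ℂ × ℂ × ℂ) := by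
      split_ifs <;> fun_prop
    exact ((mdifferentiable_chart_symm a _).comp (I' := 𝓘(ℂ, ℂ × ℂ × ℂ)) x
      ((h _).mdifferentiableAt.comp (I' := 𝓘(ℂ, ℂ × ℂ)) x
        (TotO2.mdifferentiableAt_chart hx))).mdifferentiableWithinAt
  map_eq x hx := by
    rw [sect, quot_chart_symm]
    refine Eq.trans (congrArg _ ?_) ((TotO2.chart a).left_inv hx)
    fin_cases a <;> simp [TotO2.chart]

lemma fibreCoord_vadd_sect (a : Fin 2) (x : TotO2) (t : ℂ) : fibreCoord a (t +ᵥ sect a x) = t := by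
  have h : ∀ y, coord a ((chart a).symm y) = y := fun y => (chart a).right_inv (Set.mem_univ y)
  rw [sect, vadd_chart_symm, fibreCoord, h]
  fin_cases a <;> simp

lemma fibreCoord_vadd_sect_quot {a : Fin 2} {x : TwistorSpace} (hx : x ∈ dom a) :
    fibreCoord a x +ᵥ sect a (quot x) = x := by
  have h : ∀ y, TotO2.coord a ((TotO2.chart a).symm y) = y :=
    fun y => (TotO2.chart a).right_inv (Set.mem_univ y)
  have hq : TotO2.coord a (quot x) = _ :=
    (congrArg (fun p => TotO2.coord a (quot p)) (chart_symm_coord hx).symm).trans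
      ((congrArg _ (quot_chart_symm a _)).trans (h _))
  rw [sect, hq, vadd_chart_symm]
  refine Eq.trans (congrArg _ ?_) (chart_symm_coord hx)
  fin_cases a <;> simp [fibreCoord] <;> ext <;> simp <;> ring

/-- The trivializations are given by the sections `sect a` and the fibre coordinates
`fibreCoord a`. -/
lemma isPrincipalBundle_quot :
    IsPrincipalBundle (E := ℂ × ℂ) (E' := ℂ × ℂ × ℂ) quot where
  holo_act := mdifferentiable_vadd
  holo_map := mdifferentiable_quot
  invariant t x := by
    induction x using ind with
    | h v hv =>
      rw [vadd_mk, quot_mk v hv]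
      refine (quot_mk _ _).trans (TotO2.mk_eq one_ne_zero ?_ ?_)
      · ext i
        fin_cases i <;> simp [base]
      · simp
        ring
  locally_trivial x := by
    obtain ⟨a, ha⟩ := TotO2.dom_cover x
    refine ⟨TotO2.dom a, sect a, fibreCoord a, ha, isHoloSection_sect a, fun y hy => ?_,
      fun u _ t => fibreCoord_vadd_sect a u t,
      fun y hy => fibreCoord_vadd_sect_quot (quot_mem_dom.1 hy)⟩
    have h : Differentiable ℂ fun y : ℂ × ℂ × ℂ => if a = 0 then y.2.1 else -y.2.2 := by
      split_ifs <;> fun_prop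
    exact ((h _).mdifferentiableAt.comp (I' := 𝓘(ℂ, ℂ × ℂ × ℂ)) y
      (mdifferentiableAt_chart (quot_mem_dom.1 hy))).mdifferentiableWithinAt

end TwistorSpace

/-! ### Calculus of the operator `∂/∂z̄` -/

lemma dbar_congr {f g : ℂ → ℂ} {z : ℂ} (h : f =ᶠ[nhds z] g) : dbar f z = dbar g z := by
  rw [dbar, dbar, h.fderiv_eq]

lemma dbar_neg (f : ℂ → ℂ) (z : ℂ) : dbar (fun z => -f z) z = -dbar f z := by
  simp only [dbar, fderiv_fun_neg, neg_apply]
  ring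

lemma dbar_add {f g : ℂ → ℂ} {z : ℂ} (hf : DifferentiableAt ℝ f z) (hg : DifferentiableAt ℝ g z) :
    dbar (fun z => f z + g z) z = dbar f z + dbar g z := by
  simp only [dbar, fderiv_fun_add hf hg, add_apply]
  ring

lemma dbar_mul {f g : ℂ → ℂ} {z : ℂ} (hf : DifferentiableAt ℝ f z) (hg : DifferentiableAt ℝ g z) :
    dbar (fun z => f z * g z) z = f z * dbar g z + g z * dbar f z := by
  simp only [dbar, fderiv_fun_mul hf hg, add_apply,
    smul_apply, smul_eq_mul]
  ring

/-- The Cauchy-Riemann equations, in terms of `∂/∂z̄`. -/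
lemma dbar_eq_zero_iff {f : ℂ → ℂ} {z : ℂ} (hf : DifferentiableAt ℝ f z) :
    dbar f z = 0 ↔ DifferentiableAt ℂ f z := by
  rw [differentiableAt_complex_iff_differentiableAt_real, and_iff_right hf, dbar, smul_eq_mul]
  constructor
  · intro h
    linear_combination (-2 * Complex.I) * h + fderiv ℝ f z Complex.I * Complex.I_mul_I
  · intro h
    rw [h]
    linear_combination (fderiv ℝ f z 1 / 2) * Complex.I_mul_I

lemma differentiable_conj : Differentiable ℝ (starRingEnd ℂ) := Complex.conjCLE.differentiable

lemma dbar_conj (z : ℂ) : dbar (starRingEnd ℂ) z = 1 := by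
  have h : fderiv ℝ (starRingEnd ℂ) z = Complex.conjCLE := Complex.conjCLE.fderiv
  rw [dbar, h]
  simp

lemma one_add_mul_conj_ne_zero (z : ℂ) : 1 + z * starRingEnd ℂ z ≠ 0 := by
  rw [Complex.mul_conj]
  have : (0 : ℝ) < 1 + Complex.normSq z := by linarith [Complex.normSq_nonneg z]
  exact_mod_cast this.ne'

lemma differentiable_one_add_mul_conj :
    Differentiable ℝ fun z : ℂ => 1 + z * starRingEnd ℂ z :=
  (differentiable_const 1).add (differentiable_id.mul differentiable_conj)

lemma differentiable_conj_div :
    Differentiable ℝ fun z : ℂ => starRingEnd ℂ z / (1 + z * starRingEnd ℂ z) := fun z => by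
  have h := (differentiableAt_inv (𝕜 := ℂ) (one_add_mul_conj_ne_zero z)).restrictScalars ℝ
  simp only [div_eq_mul_inv]
  exact (differentiable_conj z).mul (h.comp z (differentiable_one_add_mul_conj z))

/-- `∂/∂z̄` of `z̄ / (1 + z z̄)` is `1 / (1 + z z̄)²`. -/
lemma dbar_conj_div (z : ℂ) :
    dbar (fun z => starRingEnd ℂ z / (1 + z * starRingEnd ℂ z)) z = omegaCoeff z := by
  have hq := one_add_mul_conj_ne_zero z
  have h1 : dbar (fun z : ℂ => 1 + z * starRingEnd ℂ z) z = z := by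
    rw [dbar_add (f := fun _ => 1) (g := fun z => z * starRingEnd ℂ z) (differentiableAt_const 1)
        (differentiable_id.mul differentiable_conj z),
      dbar_mul (f := fun z => z) differentiableAt_id (differentiable_conj z), dbar_conj,
      (dbar_eq_zero_iff (differentiableAt_const 1)).2 (differentiableAt_const 1),
      (dbar_eq_zero_iff (f := fun z => z) differentiableAt_id).2 differentiableAt_id]
    simp
  -- The Leibniz rule for the product of the quotient and its denominator.
  have h2 := dbar_mul (differentiable_conj_div z) (differentiable_one_add_mul_conj z)
  have h3 : (fun z : ℂ => starRingEnd ℂ z / (1 + z * starRingEnd ℂ z) *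
      (1 + z * starRingEnd ℂ z)) = starRingEnd ℂ :=
    funext fun z => div_mul_cancel₀ _ (one_add_mul_conj_ne_zero z)
  rw [h3, dbar_conj, h1] at h2
  rw [omegaCoeff, eq_div_iff (pow_ne_zero 2 hq)]
  generalize dbar _ z = d at h2 ⊢
  rw [div_mul_eq_mul_div, div_add' _ _ _ hq, eq_div_iff hq] at h2
  linear_combination -h2

/-- `1 / (z (1 + z z̄))` differs from `-z̄ / (1 + z z̄)` by the holomorphic function `1 / z`. -/
lemma dbar_one_div_mul {z : ℂ} (hz : z ≠ 0) :
    dbar (fun z => 1 / (z * (1 + z * starRingEnd ℂ z))) z = -omegaCoeff z := by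
  have h : (fun z : ℂ => 1 / (z * (1 + z * starRingEnd ℂ z))) =ᶠ[nhds z]
      fun z => z⁻¹ + -(starRingEnd ℂ z / (1 + z * starRingEnd ℂ z)) := by
    filter_upwards [isOpen_ne.mem_nhds hz] with y hy
    have h1 := one_add_mul_conj_ne_zero y
    have h2 : y ≠ 0 := hy
    field_simp
    ring
  have hi : DifferentiableAt ℂ (fun z : ℂ => z⁻¹) z := differentiableAt_inv hz
  rw [dbar_congr h, dbar_add (hi.restrictScalars ℝ) (differentiable_conj_div z).fun_neg,
    dbar_neg, dbar_conj_div, (dbar_eq_zero_iff (hi.restrictScalars ℝ)).2 hi, zero_add]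

/-! ### The Dolbeault class of `ω` -/

lemma P1.dom_cover (x : P1) : ∃ a, x ∈ P1.dom a := by
  induction x using Projectivization.ind with
  | h v hv =>
    by_contra! h
    simp only [P1.mk_mem_dom, not_not] at h
    exact hv (funext h)

lemma mem_cone_dom {a : Fin 2} {v : Fin 2 → ℂ} : v ∈ cone (P1.dom a) ↔ v a ≠ 0 :=
  ⟨fun ⟨_, hm⟩ => P1.mk_mem_dom.1 hm,
    fun h => ⟨fun h' => h (congrFun h' a), P1.mk_mem_dom.2 h⟩⟩

lemma smul_mem_cone {U : Opens P1} {c : ℂ} (hc : c ≠ 0) {v : Fin 2 → ℂ} :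
    c • v ∈ cone U ↔ v ∈ cone U := by
  have h : ∀ (hv : v ≠ 0) (hcv : c • v ≠ 0),
      Projectivization.mk ℂ (c • v) hcv = Projectivization.mk ℂ v hv := fun hv hcv =>
    (Projectivization.mk_eq_mk_iff' ℂ _ _ _ _).2 ⟨c, rfl⟩
  constructor
  · rintro ⟨hcv, hm⟩
    have hv : v ≠ 0 := fun h => hcv (by rw [h, smul_zero])
    exact ⟨hv, h hv hcv ▸ hm⟩
  · rintro ⟨hv, hm⟩
    exact ⟨smul_ne_zero hc hv, (h hv (smul_ne_zero hc hv)).symm ▸ hm⟩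

/-- A homogeneous function is holomorphic as soon as its restrictions to the affine lines
`{zₐ = 1}` are. -/
lemma IsHomogOn.differentiableOn {k : ℤ} {U : Opens P1} {s : (Fin 2 → ℂ) → ℂ}
    (hs : IsHomogOn k U s)
    (h : ∀ a z, homog a z ∈ cone U → DifferentiableAt ℂ (fun z => s (homog a z)) z) :
    DifferentiableOn ℂ s (cone U) := by
  intro v hv
  obtain ⟨a, ha⟩ : ∃ a, v a ≠ 0 := by
    by_contra! h
    exact hv.1 (funext h)
  have hmem : ∀ y : Fin 2 → ℂ, y a ≠ 0 → y ∈ cone U → homog a (y (a + 1) / y a) ∈ cone U :=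
    fun y hya hy => (smul_mem_cone hya).1 (by rwa [homog_div a y hya])
  have hd : DifferentiableAt ℂ
      (fun y : Fin 2 → ℂ => y a ^ k * s (homog a (y (a + 1) / y a))) v := by
    have h1 : DifferentiableAt ℂ (fun y : Fin 2 → ℂ => y a) v := differentiableAt_apply a v
    have h2 : DifferentiableAt ℂ (fun y : Fin 2 → ℂ => y (a + 1) / y a) v := by
      fun_prop (disch := exact ha)
    refine (DifferentiableAt.zpow h1 (Or.inl ha)).mul ?_
    exact DifferentiableAt.comp (g := fun z => s (homog a z))
      (f := fun y : Fin 2 → ℂ => y (a + 1) / y a) v (h a _ (hmem v ha hv)) h2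
  refine (hd.congr_of_eventuallyEq ?_).differentiableWithinAt
  filter_upwards [(TotO2.isOpen_cone U).mem_nhds hv,
    (isOpen_ne_fun (continuous_apply a) continuous_const).mem_nhds ha] with y hy hya
  rw [← hs _ hya _ (hmem y hya hy), homog_div a y hya]

lemma IsHomogOn.sub {k : ℤ} {U : Opens P1} {s s' : (Fin 2 → ℂ) → ℂ} (h : IsHomogOn k U s)
    (h' : IsHomogOn k U s') : IsHomogOn k U fun v => s v - s' v := fun c hc v hv => by
  simp only [h c hc v hv, h' c hc v hv]
  ring

lemma IsOmegaPrimitive.mono {U V : Opens P1} {h : (Fin 2 → ℂ) → ℂ} (hh : IsOmegaPrimitive U h)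
    (hVU : V ≤ U) : IsOmegaPrimitive V h where
  smooth := hh.smooth.mono (cone_mono hVU)
  homog c hc v hv := hh.homog c hc v (cone_mono hVU hv)
  dbar_zero z hz := hh.dbar_zero z (cone_mono hVU hz)
  dbar_one u hu := hh.dbar_one u (cone_mono hVU hu)

lemma IsOmegaPrimitive.differentiableAt {U : Opens P1} {h : (Fin 2 → ℂ) → ℂ}
    (hh : IsOmegaPrimitive U h) {a : Fin 2} {z : ℂ} (hz : Twistor.homog a z ∈ cone U) :
    DifferentiableAt ℝ (fun z => h (Twistor.homog a z)) z :=
  DifferentiableAt.comp z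
    ((hh.smooth.differentiableOn (by simp)).differentiableAt ((TotO2.isOpen_cone U).mem_nhds hz))
    ((TotO2.differentiable_homog a z).restrictScalars ℝ)

/-- The coefficient of a primitive of `ω` in the coordinate on `{zₐ ≠ 0}` is `h` up to the sign
`(-1)ᵃ`, so `∂h/∂z̄` does not depend on the primitive. -/
lemma IsOmegaPrimitive.dbar_homog {U : Opens P1} {h : (Fin 2 → ℂ) → ℂ}
    (hh : IsOmegaPrimitive U h) (a : Fin 2) (z : ℂ) (hz : Twistor.homog a z ∈ cone U) :
    dbar (fun z => h (Twistor.homog a z)) z = if a = 0 then -omegaCoeff z else omegaCoeff z := by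
  fin_cases a
  · exact neg_eq_iff_eq_neg.1 (hh.dbar_zero z hz)
  · have := hh.dbar_one z hz
    rw [dbar_neg, neg_neg] at this
    exact this

/-- The difference of two primitives of `ω` is a holomorphic section of `O(-2)`. -/
lemma IsOmegaPrimitive.exists_sub {U : Opens P1} {h h' : (Fin 2 → ℂ) → ℂ}
    (hh : IsOmegaPrimitive U h) (hh' : IsOmegaPrimitive U h') :
    ∃ f : Sec (twist (-2)) U, ∀ v : cone U, twistFun f v = h' v - h v := by
  have hs : IsHomogOn (-2) U fun v => h' v - h v := hh'.homog.sub hh.homog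
  refine ⟨⟨fun v => h' v - h v, _, hs.differentiableOn fun a z hz => ?_, hs, fun _ => rfl⟩,
    fun _ => rfl⟩
  have h1 := hh.differentiableAt hz
  have h2 := hh'.differentiableAt hz
  simp only [sub_eq_add_neg]
  rw [← dbar_eq_zero_iff (h2.fun_add h1.fun_neg), dbar_add h2 h1.fun_neg, dbar_neg,
    hh.dbar_homog a z hz, hh'.dbar_homog a z hz, add_neg_cancel]

lemma twist_ext {k : ℤ} {U : Opens P1} {f g : Sec (twist k) U}
    (h : ∀ v, twistFun f v = twistFun g v) : f = g :=
  Subtype.ext (funext h)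

lemma twistFun_res {k : ℤ} {U V : Opens P1} (h : V ≤ U) (f : Sec (twist k) U) (v : cone V) :
    twistFun (res (twist k) h f) v = twistFun f ⟨v.1, cone_mono h v.2⟩ := rfl

lemma twistFun_add {k : ℤ} {U : Opens P1} (f g : Sec (twist k) U) (v : cone U) :
    twistFun (f + g) v = twistFun f v + twistFun g v := rfl

lemma twistFun_sub {k : ℤ} {U : Opens P1} (f g : Sec (twist k) U) (v : cone U) :
    twistFun (f - g) v = twistFun f v - twistFun g v := rfl

lemma exists_omegaCocycle {ι : Type} {V : ι → Opens P1} {h : ι → (Fin 2 → ℂ) → ℂ}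
    (hh : ∀ i, IsOmegaPrimitive (V i) (h i)) :
    ∃ g : cocycles (twist (-2)) V,
      ∀ i j (v : cone (V i ⊓ V j)), twistFun (g.1 i j) v = h j v - h i v := by
  choose g hg using fun i j =>
    ((hh i).mono (inf_le_left : V i ⊓ V j ≤ V i)).exists_sub ((hh j).mono inf_le_right)
  refine ⟨⟨g, fun i j k => twist_ext fun v => ?_⟩, hg⟩
  simp only [twistFun_add, twistFun_res, hg]
  ring

/-- The class of `ω` is independent of the cover and of the local primitives: the differences of
two families of primitives bound the difference of their cocycles. -/
lemma omegaClass_unique {a b : H1 (twist (-2))} (ha : IsOmegaClass a) (hb : IsOmegaClass b) :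
    a = b := by
  obtain ⟨ι, V, hV, h, g, hh, hg, rfl⟩ := ha
  obtain ⟨κ, V', hV', h', g', hh', hg', rfl⟩ := hb
  choose f hf using fun i j =>
    ((hh i).mono (inf_le_left : V i ⊓ V' j ≤ V i)).exists_sub ((hh' j).mono inf_le_right)
  refine cechClass_eq_of_sub _ hV hV' g g' f fun i j i' j' U hi hj hi' hj' => twist_ext fun v => ?_
  simp only [twistFun_sub, twistFun_res, hf, hg, hg']
  ring

/-- The primitives `-z̄₁ / (z₀ (|z₀|² + |z₁|²))` and `z̄₀ / (z₁ (|z₀|² + |z₁|²))` of `ω` over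
`{z₀ ≠ 0}` and `{z₁ ≠ 0}`, as homogeneous functions of degree `-2`. -/
def primitive (a : Fin 2) (v : Fin 2 → ℂ) : ℂ :=
  (if a = 0 then -1 else 1) * starRingEnd ℂ (v (a + 1)) /
    (v a * (v 0 * starRingEnd ℂ (v 0) + v 1 * starRingEnd ℂ (v 1)))

lemma sum_mul_conj_ne_zero {v : Fin 2 → ℂ} (hv : v ≠ 0) :
    v 0 * starRingEnd ℂ (v 0) + v 1 * starRingEnd ℂ (v 1) ≠ 0 := by
  simp only [Complex.mul_conj]
  intro h
  have h' : Complex.normSq (v 0) + Complex.normSq (v 1) = 0 := by exact_mod_cast h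
  have h0 := Complex.normSq_nonneg (v 0)
  have h1 := Complex.normSq_nonneg (v 1)
  have e0 : v 0 = 0 := Complex.normSq_eq_zero.1 (by linarith)
  have e1 : v 1 = 0 := Complex.normSq_eq_zero.1 (by linarith)
  refine hv (funext fun i => ?_)
  fin_cases i
  · exact e0
  · exact e1

lemma primitive_one_sub_primitive_zero {v : Fin 2 → ℂ} (h0 : v 0 ≠ 0) (h1 : v 1 ≠ 0) :
    primitive 1 v - primitive 0 v = 1 / (v 0 * v 1) := by
  have h := sum_mul_conj_ne_zero (v := v) fun h => h0 (congrFun h 0)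
  simp only [primitive, if_true, if_neg one_ne_zero, zero_add, show (1 + 1 : Fin 2) = 0 from rfl]
  generalize starRingEnd ℂ (v 0) = b0 at h ⊢
  generalize starRingEnd ℂ (v 1) = b1 at h ⊢
  rw [div_sub_div _ _ (mul_ne_zero h1 h) (mul_ne_zero h0 h), div_eq_div_iff
    (mul_ne_zero (mul_ne_zero h1 h) (mul_ne_zero h0 h)) (mul_ne_zero h0 h1)]
  ring

lemma isOmegaPrimitive_primitive (a : Fin 2) : IsOmegaPrimitive (P1.dom a) (primitive a) where
  smooth := by
    have hc : ∀ i, ContDiff ℝ ∞ fun v : Fin 2 → ℂ => v i := fun i => contDiff_apply ℝ ℂ i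
    have hc' : ∀ i, ContDiff ℝ ∞ fun v : Fin 2 → ℂ => starRingEnd ℂ (v i) := fun i =>
      Complex.conjCLE.contDiff.comp (hc i)
    unfold primitive
    simp only [div_eq_mul_inv]
    refine (contDiff_const.mul (hc' _)).contDiffOn.mul (ContDiffOn.inv
      ((hc a).mul (((hc 0).mul (hc' 0)).add ((hc 1).mul (hc' 1)))).contDiffOn fun v hv => ?_)
    exact mul_ne_zero (mem_cone_dom.1 hv) (sum_mul_conj_ne_zero hv.1)
  homog c hc v hv := by
    have h := sum_mul_conj_ne_zero hv.1
    have ha := mem_cone_dom.1 hv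
    have hc' : starRingEnd ℂ c ≠ 0 := (map_ne_zero _).2 hc
    have e : c * v 0 * (starRingEnd ℂ c * starRingEnd ℂ (v 0))
        + c * v 1 * (starRingEnd ℂ c * starRingEnd ℂ (v 1))
        = c * starRingEnd ℂ c *
          (v 0 * starRingEnd ℂ (v 0) + v 1 * starRingEnd ℂ (v 1)) := by ring
    simp only [primitive, Pi.smul_apply, smul_eq_mul, map_mul, e]
    rw [zpow_neg, zpow_ofNat]
    field_simp
  dbar_zero z hz := by
    have ha := mem_cone_dom.1 hz
    fin_cases a
    · simp only [primitive]
      simpa [neg_div, dbar_neg] using dbar_conj_div z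
    · have hz0 : z ≠ 0 := ha
      simp only [primitive]
      simpa using congrArg Neg.neg (dbar_one_div_mul hz0)
  dbar_one z hz := by
    have ha := mem_cone_dom.1 hz
    fin_cases a
    · have hz0 : z ≠ 0 := ha
      simp only [primitive]
      simpa [neg_div, dbar_neg, add_comm] using congrArg Neg.neg (dbar_one_div_mul hz0)
    · simp only [primitive]
      simpa [neg_div, dbar_neg, add_comm] using dbar_conj_div z

/-! ### Comparison of the two classes -/

lemma isOmegaClass_of_primitive {g : cocycles (twist (-2)) P1.dom}
    (hg : ∀ i j (v : cone (P1.dom i ⊓ P1.dom j)),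
      twistFun (g.1 i j) v = primitive j v - primitive i v) :
    IsOmegaClass (cechClass (twist (-2)) P1.dom P1.dom_cover g) :=
  ⟨Fin 2, P1.dom, P1.dom_cover, primitive, g, isOmegaPrimitive_primitive, hg, rfl⟩

/-- The sections `sect 0` and `sect 1` differ by the translation by `w / (z₀ z₁)`. -/
lemma TwistorSpace.vadd_sect_zero (v : Fin 2 → ℂ) (w : ℂ) (hv : v ≠ 0) (h0 : v 0 ≠ 0)
    (h1 : v 1 ≠ 0) :
    (w / (v 0 * v 1)) +ᵥ sect 0 (TotO2.mk v w hv) = sect 1 (TotO2.mk v w hv) := by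
  rw [sect_zero v w hv h0, sect_one v w hv h1, vadd_mk]
  refine mk_eq 1 ?_
  ext i
  fin_cases i <;> simp <;> field_simp
  ring

/-- The product of `w` with the cocycle of the primitives of `ω` is the cocycle of the
translations between the sections `sect a`. -/
lemma TwistorSpace.vadd_sect {i j : Fin 2} (v : Fin 2 → ℂ) (w : ℂ) (hv : v ≠ 0) (hi : v i ≠ 0)
    (hj : v j ≠ 0) :
    (w * (primitive j v - primitive i v)) +ᵥ sect i (TotO2.mk v w hv)
      = sect j (TotO2.mk v w hv) := by
  have key : ∀ h0 : v 0 ≠ 0, ∀ h1 : v 1 ≠ 0, (w * (primitive 1 v - primitive 0 v)) +ᵥ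
      sect 0 (TotO2.mk v w hv) = sect 1 (TotO2.mk v w hv) := fun h0 h1 => by
    rw [primitive_one_sub_primitive_zero h0 h1, mul_one_div]
    exact vadd_sect_zero v w hv h0 h1
  match i, j with
  | 0, 0 | 1, 1 => rw [sub_self, mul_zero, zero_vadd]
  | 0, 1 => exact key hi hj
  | 1, 0 =>
    rw [← key hj hi, vadd_vadd, ← mul_add, sub_add_sub_cancel, sub_self, mul_zero, zero_vadd]

end Twistor

end

open Twistor in
theorem mainTheorem2 :
    IsPrincipalBundle (E := ℂ × ℂ) (E' := ℂ × ℂ × ℂ) TwistorSpace.quot ∧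
    ∃ (α : H1 (holo (E := ℂ × ℂ) TotO2)) (κ : H1 (twist (-2)))
      (g : cocycles (holo (E := ℂ × ℂ) TotO2) TotO2.dom),
      (∀ a, IsBundleClass (E' := ℂ × ℂ × ℂ) TwistorSpace.quot a ↔ a = α) ∧
      (∀ b, IsOmegaClass b ↔ b = κ) ∧
      (∃ c : ℂ, c ≠ 0 ∧ α = c • TotO2.mulTautH1 κ) ∧
      (∀ (z : Fin 2 → ℂ) (w : ℂ) (hz : z ≠ 0)
        (h : TotO2.mk z w hz ∈ TotO2.dom 0 ⊓ TotO2.dom 1),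
        holoFun (g.1 0 1) ⟨TotO2.mk z w hz, h⟩ = w / (z 0 * z 1)) ∧
      cechClass (holo (E := ℂ × ℂ) TotO2) TotO2.dom TotO2.dom_cover g = α ∧
      cechClass (holo (E := ℂ × ℂ) TotO2) TotO2.dom TotO2.dom_cover g = TotO2.mulTautH1 κ := by
  obtain ⟨k, hk⟩ := exists_omegaCocycle isOmegaPrimitive_primitive
  let g : cocycles (holo (E := ℂ × ℂ) TotO2) TotO2.dom :=
    mapCocycle TotO2.proj (twist (-2)) (holo (E := ℂ × ℂ) TotO2) TotO2.mulTaut P1.dom k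
  have hg : ∀ i j (z : Fin 2 → ℂ) (w : ℂ) (hz : z ≠ 0)
      (h : TotO2.mk z w hz ∈ TotO2.dom i ⊓ TotO2.dom j),
      holoFun (g.1 i j) ⟨TotO2.mk z w hz, h⟩ = w * (primitive j z - primitive i z) :=
    fun i j z w hz h => (TotO2.holoFun_mulTaut (k.1 i j) z w hz h).trans
      (congrArg (w * ·) (hk i j ⟨z, hz, h⟩))
  have hmul : TotO2.mulTautH1 (cechClass (twist (-2)) P1.dom P1.dom_cover k)
      = cechClass (holo (E := ℂ × ℂ) TotO2) TotO2.dom TotO2.dom_cover g :=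
    mapH1_cechClass TotO2.proj (twist (-2)) (holo (E := ℂ × ℂ) TotO2) TotO2.mulTaut P1.dom
      P1.dom_cover k
  have hα : IsBundleClass (E' := ℂ × ℂ × ℂ) TwistorSpace.quot
      (cechClass (holo (E := ℂ × ℂ) TotO2) TotO2.dom TotO2.dom_cover g) := by
    refine ⟨Fin 2, TotO2.dom, TotO2.dom_cover, TwistorSpace.sect, g,
      TwistorSpace.isHoloSection_sect, ?_, rfl⟩
    rintro i j ⟨u, hu⟩
    induction u using TotO2.ind with
    | h v w hv =>
      rw [hg i j v w hv hu]
      exact TwistorSpace.vadd_sect v w hv (TotO2.mk_mem_dom.1 hu.1) (TotO2.mk_mem_dom.1 hu.2)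
  have hκ := isOmegaClass_of_primitive hk
  have hq := TwistorSpace.isPrincipalBundle_quot
  refine ⟨hq, _, _, g, fun a => ⟨fun ha => hq.bundleClass_unique ha hα, fun ha => ha ▸ hα⟩,
    fun b => ⟨fun hb => omegaClass_unique hb hκ, fun hb => hb ▸ hκ⟩,
    ⟨1, one_ne_zero, by rw [one_smul, hmul]⟩, fun z w hz h => ?_, rfl, hmul.symm⟩
  rw [hg 0 1 z w hz h, primitive_one_sub_primitive_zero (TotO2.mk_mem_dom.1 h.1)
    (TotO2.mk_mem_dom.1 h.2), mul_one_div]
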